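/- Let $0<q<1$, $\gamma\in\mathbb C$, $N$ a positive integer and $n\in\{0,1,\dots,N\}$. Put $(a;q)_k=\prod_{j=0}^{k-1}(1-aq^j)$ and $(a_1,\dots,a_r;q)_k=\prod_i (a_i;q)_k$, $${}_4\phi_3\left[{a_1,a_2,a_3,a_4\atop b_1,b_2,b_3};q,z\right]=\sum_{k\ge 0}\frac{(a_1,a_2,a_3,a_4;q)_k}{(b_1,b_2,b_3,q;q)_k}\,z^k$$ (a terminating series is summed up to its last term with nonzero numerator), and let $R_n(y;\alpha,\beta,\gamma,\delta\,|\,q)$ be the $q$-Racah polynomial in $y$, $$R_n(q^{-x}+\gamma\delta q^{x+1};\alpha,\beta,\gamma,\delta\,|\,q)={}_4\phi_3\left[{q^{-n},\alpha\beta q^{n+1},q^{-x},\gamma\delta q^{x+1}\atop \alpha q,\beta\delta q,\gamma q};q,q\right],$$ that is, $$R_n(y;\alpha,\beta,\gamma,\delta\,|\,q)=\sum_{k=0}^n\frac{(q^{-n},\alpha\beta q^{n+1};q)_k\prod_{j=0}^{k-1}(1-yq^j+\gamma\delta q^{2j+1})}{(\alpha q,\beta\delta q,\gamma q,q;q)_k}\,q^k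 .$$ (i) Suppose $\gamma q^j\ne1$ for $1\le j\le 2n$. Then $${}_4\phi_3\left[{q^{-2n},q^{-2(N-n)-1},q^{-x},-\gamma q^{x+1}\atop q^{-N},-q^{-N},\gamma q};q,q\right]={}_4\phi_3\left[{q^{-2n},q^{2n-2N-1},q^{-2x},\gamma^2q^{2x+2}\atop q^{-2N},\gamma q,\gamma q^2};q^2,q^2\right]$$ for all $x\in\mathbb C$ if $2n\le N$, and for $x=0,1,\dots,N$ if $2n>N$. Moreover $$R_n(q^{-2x}+\gamma^2q^{2x+2};q^{-2N-2},q^{-1},\gamma,\gamma\,|\,q^2)=\begin{cases}R_{2n}(q^{-x}-\gamma q^{x+1};q^{-N-1},q^{-N-1},\gamma,-1\,|\,q)&(2n\le N),\\ R_{2N-2n+1}(q^{-x}-\gamma q^{x+1};q^{-N-1},q^{-N-1},\gamma,-1\,|\,q)&(2n>N),\end{cases}$$ where the first case holds for all $x\in\mathbb C$, and indeed as an identity in all $y\in\mathbb C$, with $y=q^{-x}-\gamma q^{x+1}$ and $y^2+2\gamma q=q^{-2x}+\gamma^2q^{2x+2}$, while the second case holds for $x=0,1,\dots,N$ but is not an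 identity in $y$: written in terms of $y$, it holds for only finitely many $y\in\mathbb C$. (ii) Suppose $\gamma q^j\ne1$ for $1\le j\le 2n+1$. Then $${}_4\phi_3\left[{q^{-2n-1},q^{-2(N-n)},q^{-x},-\gamma q^{x+1}\atop q^{-N},-q^{-N},\gamma q};q,q\right]=\frac{q^{-x}-\gamma q^{x+1}}{1-\gamma q}\;{}_4\phi_3\left[{q^{-2n},q^{2n-2N+1},q^{-2x},\gamma^2q^{2x+2}\atop q^{-2N},\gamma q^2,\gamma q^3};q^2,q^2\right]$$ for all $x\in\mathbb C$ if $2n+1\le N$, and for $x=0,1,\dots,N$ if $2n+1>N$. Moreover $$\frac{q^{-x}-\gamma q^{x+1}}{1-\gamma q}\,R_n(q^{-2x}+\gamma^2q^{2x+2};q^{-2N-2},q,\gamma,\gamma\,|\,q^2)=\begin{cases}R_{2n+1}(q^{-x}-\gamma q^{x+1};q^{-N-1},q^{-N-1},\gamma,-1\,|\,q)&(2n+1\le N),\\ R_{2N-2n}(q^{-x}-\gamma q^{x+1};q^{-N-1},q^{-N-1},\gamma,-1\,|\,q)&(2n+1>N),\end{cases}$$ where again the first case holds for all $x\in\mathbb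 C$ and for all $y\in\mathbb C$ (with $y$ as in (i)), while the second case holds for $x=0,1,\dots,N$ but, written in terms of $y$, for only finitely many $y\in\mathbb C$. -/

import Mathlib

noncomputable section

/-- The `q`-shifted factorial `(a; q)_k = ∏_{j < k} (1 - a q^j)`. -/
def qPoch (a q : ℂ) (k : ℕ) : ℂ :=
  ∏ j ∈ Finset.range k, (1 - a * q ^ j)

/-- The basic hypergeometric series `₄φ₃(a₁, a₂, a₃, a₄; b₁, b₂, b₃; q, z)`. -/
def qHyp43 (a₁ a₂ a₃ a₄ b₁ b₂ b₃ q z : ℂ) : ℂ :=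
  ∑' k : ℕ, qPoch a₁ q k * qPoch a₂ q k * qPoch a₃ q k * qPoch a₄ q k /
    (qPoch b₁ q k * qPoch b₂ q k * qPoch b₃ q k * qPoch q q k) * z ^ k

/-- The `q`-Racah polynomial `R_n(y; α, β, γ, δ | q)` as a polynomial function of `y ∈ ℂ`.
It is the terminating `₄φ₃` series in which the factor `(q^{-x}; q)_k (γδq^{x+1}; q)_k` is written
as the polynomial `∏_{j < k} (1 - y q^j + γδ q^{2j+1})` in `y = q^{-x} + γδq^{x+1}`; see
`qRacah_lattice` for the `₄φ₃` form. -/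
def qRacah (n : ℕ) (y α β γ δ q : ℂ) : ℂ :=
  ∑ k ∈ Finset.range (n + 1),
    qPoch (q ^ (-(n : ℤ))) q k * qPoch (α * β * q ^ (n + 1)) q k *
        (∏ j ∈ Finset.range k, (1 - y * q ^ j + γ * δ * q ^ (2 * j + 1))) /
      (qPoch (α * q) q k * qPoch (β * δ * q) q k * qPoch (γ * q) q k * qPoch q q k) * q ^ k

end

/-- The defining formula of the `q`-Racah polynomials,
`R_n(q^{-x} + γδq^{x+1}; α, β, γ, δ | q)
  = ₄φ₃(q^{-n}, αβq^{n+1}, q^{-x}, γδq^{x+1}; αq, βδq, γq; q, q)`, for complex `x`. -/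
theorem qRacah_lattice (n : ℕ) (x α β γ δ q : ℂ) (hq : q ≠ 0) :
    qRacah n (q ^ (-x) + γ * δ * q ^ (x + 1)) α β γ δ q =
      qHyp43 (q ^ (-(n : ℤ))) (α * β * q ^ (n + 1)) (q ^ (-x)) (γ * δ * q ^ (x + 1))
        (α * q) (β * δ * q) (γ * q) q q := by
  unfold qRacah qHyp43
  rw [tsum_eq_sum (s := Finset.range (n + 1))]
  · refine Finset.sum_congr rfl fun k _ => ?_
    have h : ∏ j ∈ Finset.range k,
        (1 - (q ^ (-x) + γ * δ * q ^ (x + 1)) * q ^ j + γ * δ * q ^ (2 * j + 1)) =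
        qPoch (q ^ (-x)) q k * qPoch (γ * δ * q ^ (x + 1)) q k := by
      unfold qPoch
      rw [← Finset.prod_mul_distrib]
      refine Finset.prod_congr rfl fun j _ => ?_
      have h1 : q ^ (-x) * q ^ (x + 1) = q := by
        rw [← Complex.cpow_add _ _ hq]; simp
      have h2 : q ^ (2 * j + 1) = q ^ j * q ^ j * (q ^ (-x) * q ^ (x + 1)) := by
        rw [h1]; ring
      rw [h2]; ring
    rw [h]; ring
  · intro k hk
    have hk' : n < k := by simpa using hk
    have h0 : qPoch (q ^ (-(n : ℤ))) q k = 0 := by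
      unfold qPoch
      refine Finset.prod_eq_zero (Finset.mem_range.mpr hk') ?_
      rw [zpow_neg, zpow_natCast, inv_mul_cancel₀ (pow_ne_zero _ hq), sub_self]
    rw [h0]; simp

/-! With `t = q^x`, each series is a combination of the functions `(t⁻¹, et; q)_k`, on which the
`q`-Racah difference operator is bidiagonal: it sends the `k`-th one to a combination of the `k`-th
and the `(k-1)`-st. For balanced parameters the off-diagonal contributions telescope, so the series
is an eigenfunction with eigenvalue `-(1 - A)(1 - B)` (`difference_latticeSum`). In the even case
the base `q²` operator at `t²` has the same coefficients as the base `q` operator at `t`; in the odd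
case they are related by conjugation with `t⁻¹ - γqt`, which also shifts the eigenvalue. The
backward coefficient vanishes at `t = 1`, so on `1, q, …, q^N` the equation is a recurrence
determined by the value at `1`, which is `1` on both sides (`eq_on_lattice_of_difference_eq`).

If the degree in `y` is at most `N`, agreement at `N + 1` distinct lattice values of `y` is a
polynomial identity. Otherwise only the lattice identity survives. There the base `q` series has
upper parameters `q^{-M}` and `q^{-M'}` with `M + M' = 2N + 1`; exchanging them replaces `M` by `M'
≤ N`, which is below the degree of the base `q²` side, so off the lattice only finitely many
coincidences remain.

All this is done for nonreal `γ`, where no factor `1 ± γr` with `r` real vanishes. Continuity in `γ`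
then gives every admissible `γ`. -/

noncomputable section

/-! ### The lattice basis and the `q`-Racah difference operator -/

theorem qPoch_zero (a q : ℂ) : qPoch a q 0 = 1 := by simp [qPoch]

theorem qPoch_succ (a q : ℂ) (k : ℕ) : qPoch a q (k + 1) = qPoch a q k * (1 - a * q ^ k) := by
  simp [qPoch, Finset.prod_range_succ]

theorem qPoch_succ' (a q : ℂ) (k : ℕ) : qPoch a q (k + 1) = (1 - a) * qPoch (a * q) q k := by
  simp only [qPoch, Finset.prod_range_succ', pow_zero, mul_one]
  rw [mul_comm]
  congr 1
  exact Finset.prod_congr rfl fun j _ => by ring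

theorem qPoch_ne_zero {a q : ℂ} {k : ℕ} (h : ∀ j < k, 1 - a * q ^ j ≠ 0) : qPoch a q k ≠ 0 :=
  Finset.prod_ne_zero_iff.mpr fun j hj => h j (Finset.mem_range.mp hj)

theorem qPoch_eq_zero {a q : ℂ} {j k : ℕ} (hj : j < k) (h : 1 - a * q ^ j = 0) :
    qPoch a q k = 0 :=
  Finset.prod_eq_zero (Finset.mem_range.mpr hj) h

/-- The basis function `(q^{-x}, e q^x; q)_k` of the `q`-quadratic lattice, with `t = q^x`. -/
def latticeBasis (e q : ℂ) (k : ℕ) (t : ℂ) : ℂ := qPoch t⁻¹ q k * qPoch (e * t) q k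

/-- The coefficient of `latticeBasis` in a `₄φ₃` series with argument `q`. -/
def latticeCoeff (A B b₁ b₂ b₃ q : ℂ) (k : ℕ) : ℂ :=
  qPoch A q k * qPoch B q k / (qPoch b₁ q k * qPoch b₂ q k * qPoch b₃ q k * qPoch q q k) * q ^ k

/-- The `₄φ₃` series truncated after its `N`-th term, as a function of `t = q^x`. -/
def latticeSum (N : ℕ) (A B b₁ b₂ b₃ e q t : ℂ) : ℂ :=
  ∑ k ∈ Finset.range (N + 1), latticeCoeff A B b₁ b₂ b₃ q k * latticeBasis e q k t

/-- The coefficient of the forward shift in the `q`-Racah difference operator. -/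
def forwardCoeff (b₁ b₂ b₃ e q t : ℂ) : ℂ :=
  (1 - b₁ * t) * (1 - b₂ * t) * (1 - b₃ * t) * (1 - e * t) /
    ((1 - e * t ^ 2) * (1 - e * q * t ^ 2))

/-- The coefficient of the backward shift in the `q`-Racah difference operator. -/
def backwardCoeff (b₁ b₂ b₃ e q t : ℂ) : ℂ :=
  (1 - t) * (b₁ - e * t) * (b₂ - e * t) * (b₃ - e * t) /
    (e * (q - e * t ^ 2) * (1 - e * t ^ 2))

theorem latticeBasis_zero (e q t : ℂ) : latticeBasis e q 0 t = 1 := by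
  simp [latticeBasis, qPoch_zero]

theorem latticeBasis_succ (e q t : ℂ) (k : ℕ) :
    latticeBasis e q (k + 1) t =
      latticeBasis e q k t * ((1 - t⁻¹ * q ^ k) * (1 - e * t * q ^ k)) := by
  simp only [latticeBasis, qPoch_succ]; ring

/-- The factor `1 - e t` of the forward coefficient supplies the missing first factor of `(et; q)`,
so the shifted basis function becomes a multiple of the unshifted one of index `k`. The backward
shift uses `1 - t` in the same way. -/
theorem latticeBasis_forward (e q t : ℂ) (k : ℕ) (hq : q ≠ 0) :
    (1 - e * t) * latticeBasis e q (k + 1) (q * t) =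
      latticeBasis e q k t *
        ((1 - t⁻¹ * q⁻¹) * (1 - e * t * q ^ k) * (1 - e * t * q ^ (k + 1))) := by
  have h1 : qPoch (q * t)⁻¹ q (k + 1) = (1 - t⁻¹ * q⁻¹) * qPoch t⁻¹ q k := by
    rw [qPoch_succ', mul_inv]
    congr 2
    · ring
    · field_simp
  have h2 : (1 - e * t) * qPoch (e * (q * t)) q (k + 1) =
      qPoch (e * t) q k * ((1 - e * t * q ^ k) * (1 - e * t * q ^ (k + 1))) := by
    rw [show e * (q * t) = e * t * q by ring, ← qPoch_succ', qPoch_succ, qPoch_succ]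
    ring
  simp only [latticeBasis]
  rw [h1]
  linear_combination (1 - t⁻¹ * q⁻¹) * qPoch t⁻¹ q k * h2

theorem latticeBasis_backward (e q t : ℂ) (k : ℕ) (hq : q ≠ 0) (ht : t ≠ 0) :
    (1 - t) * latticeBasis e q (k + 1) (t / q) =
      -t * latticeBasis e q k t *
        ((1 - t⁻¹ * q ^ k) * (1 - t⁻¹ * q ^ (k + 1)) * (1 - e * t / q)) := by
  have h1 : (1 - t⁻¹) * qPoch (t / q)⁻¹ q (k + 1) =
      qPoch t⁻¹ q k * ((1 - t⁻¹ * q ^ k) * (1 - t⁻¹ * q ^ (k + 1))) := by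
    rw [show (t / q)⁻¹ = t⁻¹ * q by rw [inv_div]; ring, ← qPoch_succ', qPoch_succ, qPoch_succ]
    ring
  have h2 : qPoch (e * (t / q)) q (k + 1) = (1 - e * t / q) * qPoch (e * t) q k := by
    rw [qPoch_succ']
    congr 2
    · ring
    · field_simp
  have h3 : 1 - t = -t * (1 - t⁻¹) := by field_simp; ring
  simp only [latticeBasis]
  rw [h2, h3]
  linear_combination -t * ((1 - e * t / q) * qPoch (e * t) q k) * h1

/-- After division by the common factor `latticeBasis e q k t`, this is a rational identity in `t`
and `q^k`. -/
theorem difference_latticeBasis (b₁ b₂ b₃ e q t : ℂ) (k : ℕ) (hq : q ≠ 0) (ht : t ≠ 0)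
    (he : e ≠ 0) (h1 : 1 - e * t ^ 2 ≠ 0) (h2 : 1 - e * q * t ^ 2 ≠ 0) (h3 : q - e * t ^ 2 ≠ 0) :
    forwardCoeff b₁ b₂ b₃ e q t *
          (latticeBasis e q (k + 1) (q * t) - latticeBasis e q (k + 1) t) +
        backwardCoeff b₁ b₂ b₃ e q t *
          (latticeBasis e q (k + 1) (t / q) - latticeBasis e q (k + 1) t) =
      -(1 - (q ^ (k + 1))⁻¹) * (1 - b₁ * b₂ * b₃ / (q * e) * q ^ (k + 1)) *
          latticeBasis e q (k + 1) t -
        (q ^ (k + 1))⁻¹ * (1 - b₁ * q ^ k) * (1 - b₂ * q ^ k) * (1 - b₃ * q ^ k) *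
          (1 - q ^ (k + 1)) * latticeBasis e q k t := by
  have hF : forwardCoeff b₁ b₂ b₃ e q t * latticeBasis e q (k + 1) (q * t) =
      (1 - b₁ * t) * (1 - b₂ * t) * (1 - b₃ * t) / ((1 - e * t ^ 2) * (1 - e * q * t ^ 2)) *
      (latticeBasis e q k t *
        ((1 - t⁻¹ * q⁻¹) * (1 - e * t * q ^ k) * (1 - e * t * q ^ (k + 1)))) := by
    rw [← latticeBasis_forward e q t k hq]; unfold forwardCoeff; ring
  have hB : backwardCoeff b₁ b₂ b₃ e q t * latticeBasis e q (k + 1) (t / q) =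
      (b₁ - e * t) * (b₂ - e * t) * (b₃ - e * t) / (e * (q - e * t ^ 2) * (1 - e * t ^ 2)) *
      (-t * latticeBasis e q k t *
        ((1 - t⁻¹ * q ^ k) * (1 - t⁻¹ * q ^ (k + 1)) * (1 - e * t / q))) := by
    rw [← latticeBasis_backward e q t k hq ht]; unfold backwardCoeff; ring
  rw [mul_sub, mul_sub, hF, hB, latticeBasis_succ]
  generalize latticeBasis e q k t = P
  unfold forwardCoeff backwardCoeff
  clear hF hB
  simp only [pow_succ q k]
  have hw : q ^ k ≠ 0 := pow_ne_zero _ hq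
  generalize q ^ k = w at hw ⊢
  -- The denominators are kept as atoms while fractions are cleared, and expanded only for the final
  -- polynomial identity.
  generalize hd1 : 1 - e * t ^ 2 = d1 at *
  generalize hd2 : 1 - e * q * t ^ 2 = d2 at *
  generalize hd3 : q - e * t ^ 2 = d3 at *
  field_simp
  rw [← hd1, ← hd2, ← hd3]
  ring

theorem latticeCoeff_succ (A B b₁ b₂ b₃ q : ℂ) (k : ℕ) (h1 : 1 - b₁ * q ^ k ≠ 0)
    (h2 : 1 - b₂ * q ^ k ≠ 0) (h3 : 1 - b₃ * q ^ k ≠ 0) (h4 : 1 - q ^ (k + 1) ≠ 0) :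
    latticeCoeff A B b₁ b₂ b₃ q (k + 1) *
        ((1 - b₁ * q ^ k) * (1 - b₂ * q ^ k) * (1 - b₃ * q ^ k) * (1 - q ^ (k + 1))) =
      latticeCoeff A B b₁ b₂ b₃ q k * (q * (1 - A * q ^ k) * (1 - B * q ^ k)) := by
  have h4' : 1 - q * q ^ k ≠ 0 := by rwa [← pow_succ']
  simp only [latticeCoeff, qPoch_succ]
  rw [show (qPoch b₁ q k * (1 - b₁ * q ^ k) * (qPoch b₂ q k * (1 - b₂ * q ^ k)) *
      (qPoch b₃ q k * (1 - b₃ * q ^ k)) * (qPoch q q k * (1 - q * q ^ k))) =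
      (qPoch b₁ q k * qPoch b₂ q k * qPoch b₃ q k * qPoch q q k) * ((1 - b₁ * q ^ k) *
      (1 - b₂ * q ^ k) * (1 - b₃ * q ^ k) * (1 - q ^ (k + 1))) by ring, ← div_div]
  have hd : (1 - b₁ * q ^ k) * (1 - b₂ * q ^ k) * (1 - b₃ * q ^ k) * (1 - q ^ (k + 1)) ≠ 0 := by
    positivity
  generalize (1 - b₁ * q ^ k) * (1 - b₂ * q ^ k) * (1 - b₃ * q ^ k) * (1 - q ^ (k + 1)) = d at *
  generalize qPoch b₁ q k * qPoch b₂ q k * qPoch b₃ q k * qPoch q q k = D at *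
  rw [mul_right_comm, div_mul_cancel₀ _ hd]
  ring

theorem difference_latticeSum (N : ℕ) (A B b₁ b₂ b₃ e q t : ℂ) (hq : q ≠ 0) (ht : t ≠ 0)
    (he : e ≠ 0) (h1 : 1 - e * t ^ 2 ≠ 0) (h2 : 1 - e * q * t ^ 2 ≠ 0) (h3 : q - e * t ^ 2 ≠ 0)
    (hb₁ : ∀ k < N, 1 - b₁ * q ^ k ≠ 0) (hb₂ : ∀ k < N, 1 - b₂ * q ^ k ≠ 0)
    (hb₃ : ∀ k < N, 1 - b₃ * q ^ k ≠ 0) (hqk : ∀ k < N, 1 - q ^ (k + 1) ≠ 0)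
    (hbal : A * B * q * e = b₁ * b₂ * b₃) (htop : latticeBasis e q N t = 0) :
    forwardCoeff b₁ b₂ b₃ e q t *
          (latticeSum N A B b₁ b₂ b₃ e q (q * t) - latticeSum N A B b₁ b₂ b₃ e q t) +
        backwardCoeff b₁ b₂ b₃ e q t *
          (latticeSum N A B b₁ b₂ b₃ e q (t / q) - latticeSum N A B b₁ b₂ b₃ e q t) =
      -(1 - A) * (1 - B) * latticeSum N A B b₁ b₂ b₃ e q t := by
  -- Balancing enters here: the diagonal entry at index `k` becomes `-(1 - q^{-k})(1 - AB q^k)`.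
  have hAB : b₁ * b₂ * b₃ / (q * e) = A * B := by
    rw [← hbal]; field_simp
  -- A partial sum satisfies the equation up to one boundary term at its top index; at `M = N` that
  -- term is killed by `htop`. Termination through `A` or `B` plays no role.
  have key : ∀ M ≤ N, forwardCoeff b₁ b₂ b₃ e q t *
          (latticeSum M A B b₁ b₂ b₃ e q (q * t) - latticeSum M A B b₁ b₂ b₃ e q t) +
        backwardCoeff b₁ b₂ b₃ e q t *
          (latticeSum M A B b₁ b₂ b₃ e q (t / q) - latticeSum M A B b₁ b₂ b₃ e q t) =
      -(1 - A) * (1 - B) * latticeSum M A B b₁ b₂ b₃ e q t +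
        (q ^ M)⁻¹ * (1 - A * q ^ M) * (1 - B * q ^ M) *
          (latticeCoeff A B b₁ b₂ b₃ q M * latticeBasis e q M t) := by
    intro M hM
    induction M with
    | zero =>
      simp [latticeSum, latticeBasis_zero]
      ring
    | succ M ih =>
      have ih := ih (by omega)
      have hM : M < N := by omega
      have hd := difference_latticeBasis b₁ b₂ b₃ e q t M hq ht he h1 h2 h3
      have hc := latticeCoeff_succ A B b₁ b₂ b₃ q M (hb₁ M hM) (hb₂ M hM) (hb₃ M hM) (hqk M hM)
      have hs : ∀ t, latticeSum (M + 1) A B b₁ b₂ b₃ e q t = latticeSum M A B b₁ b₂ b₃ e q t +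
          latticeCoeff A B b₁ b₂ b₃ q (M + 1) * latticeBasis e q (M + 1) t := fun t => by
        rw [latticeSum, Finset.sum_range_succ]; rfl
      rw [hAB] at hd
      rw [hs, hs, hs]
      have hw : q ^ M ≠ 0 := pow_ne_zero _ hq
      have hi : (q ^ M)⁻¹ = q * (q ^ (M + 1))⁻¹ := by rw [pow_succ]; field_simp
      have hi' : q ^ (M + 1) * (q ^ (M + 1))⁻¹ = 1 := mul_inv_cancel₀ (pow_ne_zero _ hq)
      rw [hi] at ih
      generalize latticeCoeff A B b₁ b₂ b₃ q (M + 1) = c' at *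
      generalize latticeCoeff A B b₁ b₂ b₃ q M = c at *
      generalize latticeBasis e q (M + 1) t = p' at *
      generalize latticeBasis e q M t = p at *
      generalize (q ^ (M + 1))⁻¹ = v at *
      -- The subdiagonal part of `hd` cancels the boundary term of `ih` through the coefficient
      -- recurrence `hc`.
      linear_combination ih + c' * hd - v * p * hc +
        c' * p' * (A + B - A * B - A * B * q ^ (M + 1)) * hi'
  rw [key N le_rfl, htop]
  ring

/-! ### Uniqueness for the lattice recurrence, and nonreal parameters -/

theorem eq_on_lattice_of_difference_eq {q lam : ℂ} {U V f g : ℂ → ℂ} {N : ℕ} (hq : q ≠ 0)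
    (hU : ∀ m < N, U (q ^ m) ≠ 0) (hV : V 1 = 0) (h0 : f 1 = g 1)
    (hf : ∀ m < N, U (q ^ m) * (f (q * q ^ m) - f (q ^ m)) +
      V (q ^ m) * (f (q ^ m / q) - f (q ^ m)) = lam * f (q ^ m))
    (hg : ∀ m < N, U (q ^ m) * (g (q * q ^ m) - g (q ^ m)) +
      V (q ^ m) * (g (q ^ m / q) - g (q ^ m)) = lam * g (q ^ m)) :
    ∀ m ≤ N, f (q ^ m) = g (q ^ m) := by
  intro m
  induction m using Nat.strong_induction_on with
  | _ m ih =>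
    intro hm
    rcases m with _ | m
    · simpa using h0
    have e1 := ih m (by omega) (by omega)
    -- At `m = 0` the point `q⁻¹` is off the lattice, but its coefficient `V 1` is zero.
    have hb : V (q ^ m) * f (q ^ m / q) = V (q ^ m) * g (q ^ m / q) := by
      rcases m with _ | m
      · simp [hV]
      · have : q ^ (m + 1) / q = q ^ m := by rw [pow_succ]; field_simp
        rw [this, ih m (by omega) (by omega)]
    have hfm := hf m (by omega)
    have hgm := hg m (by omega)
    rw [e1] at hfm
    apply mul_left_cancel₀ (hU m (by omega))
    rw [pow_succ']
    linear_combination hfm - hgm - hb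

theorem one_sub_mul_ofReal_ne_zero {γ : ℂ} (hγ : γ.im ≠ 0) (r : ℝ) : 1 - γ * (r : ℂ) ≠ 0 := by
  intro h
  have h2 := congrArg Complex.im h
  have h3 := congrArg Complex.re h
  simp at h2 h3
  rcases h2 with h2 | h2
  · exact hγ h2
  · simp [h2] at h3

theorem one_add_mul_ofReal_ne_zero {γ : ℂ} (hγ : γ.im ≠ 0) (r : ℝ) : 1 + γ * (r : ℂ) ≠ 0 := by
  have := one_sub_mul_ofReal_ne_zero hγ (-r)
  push_cast at this
  simpa using this

theorem latticeBasis_eq_zero {e q : ℂ} {m k : ℕ} (hq : q ≠ 0) (h : m < k) :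
    latticeBasis e q k (q ^ m) = 0 := by
  rw [latticeBasis, qPoch_eq_zero h (by rw [inv_mul_cancel₀ (pow_ne_zero _ hq), sub_self]),
    zero_mul]

theorem latticeSum_one (N : ℕ) (A B b₁ b₂ b₃ e : ℂ) {q : ℂ} (hq : q ≠ 0) :
    latticeSum N A B b₁ b₂ b₃ e q 1 = 1 := by
  rw [latticeSum, Finset.sum_range_succ', Finset.sum_eq_zero]
  · simp [latticeCoeff, latticeBasis, qPoch_zero]
  · intro k _
    have := latticeBasis_eq_zero (e := e) (m := 0) (k := k + 1) hq (by omega)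
    rw [pow_zero] at this
    rw [this, mul_zero]

/-! ### Comparison of the base `q` and base `q²` operators -/

section Coefficients

variable {q γ s t : ℂ}

/-- The lower parameters `γq, γq²` cancel the factors `1 - γqt²` and `1 - γq²t²` of the base `q²`
denominator, leaving the base `q` denominator. -/
theorem forwardCoeff_quadratic (h1 : 1 - γ * (q * t ^ 2) ≠ 0) (h2 : 1 + γ * (q * t ^ 2) ≠ 0)
    (h3 : 1 - γ * (q ^ 2 * t ^ 2) ≠ 0) (h4 : 1 + γ * (q ^ 2 * t ^ 2) ≠ 0) :
    forwardCoeff (s ^ 2) (γ * q) (γ * q ^ 2) (γ ^ 2 * q ^ 2) (q ^ 2) (t ^ 2) =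
      forwardCoeff s (-s) (γ * q) (-γ * q) q t := by
  unfold forwardCoeff
  rw [show (1 - γ ^ 2 * q ^ 2 * (t ^ 2) ^ 2) * (1 - γ ^ 2 * q ^ 2 * q ^ 2 * (t ^ 2) ^ 2) =
    (1 - γ * (q * t ^ 2)) * (1 + γ * (q * t ^ 2)) *
      ((1 - γ * (q ^ 2 * t ^ 2)) * (1 + γ * (q ^ 2 * t ^ 2))) by ring,
    show (1 - -γ * q * t ^ 2) * (1 - -γ * q * q * t ^ 2) =
      (1 + γ * (q * t ^ 2)) * (1 + γ * (q ^ 2 * t ^ 2)) by ring,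
    div_eq_div_iff (by positivity) (by positivity)]
  ring

theorem backwardCoeff_quadratic (hq : q ≠ 0) (hγ : γ ≠ 0) (h1 : 1 - γ * (q * t ^ 2) ≠ 0)
    (h2 : 1 + γ * (q * t ^ 2) ≠ 0) (h3 : 1 - γ * t ^ 2 ≠ 0) (h4 : 1 + γ * t ^ 2 ≠ 0) :
    backwardCoeff (s ^ 2) (γ * q) (γ * q ^ 2) (γ ^ 2 * q ^ 2) (q ^ 2) (t ^ 2) =
      backwardCoeff s (-s) (γ * q) (-γ * q) q t := by
  unfold backwardCoeff
  rw [show γ ^ 2 * q ^ 2 * (q ^ 2 - γ ^ 2 * q ^ 2 * (t ^ 2) ^ 2) *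
      (1 - γ ^ 2 * q ^ 2 * (t ^ 2) ^ 2) =
    γ ^ 2 * q ^ 4 * ((1 - γ * (q * t ^ 2)) * (1 + γ * (q * t ^ 2)) *
      ((1 - γ * t ^ 2) * (1 + γ * t ^ 2))) by ring,
    show -γ * q * (q - -γ * q * t ^ 2) * (1 - -γ * q * t ^ 2) =
      -(γ * q ^ 2) * ((1 + γ * (q * t ^ 2)) * (1 + γ * t ^ 2)) by ring,
    div_eq_div_iff (by positivity) (mul_ne_zero (by simp [hq, hγ]) (by positivity))]
  ring

theorem forwardCoeff_quadratic_odd (hq : q ≠ 0) (ht : t ≠ 0) (h1 : 1 - γ * (q * t ^ 2) ≠ 0)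
    (h2 : 1 + γ * (q * t ^ 2) ≠ 0)
    (h3 : 1 - γ * (q ^ 2 * t ^ 2) ≠ 0) (h4 : 1 + γ * (q ^ 2 * t ^ 2) ≠ 0) :
    (t⁻¹ - γ * q * t) *
        forwardCoeff (s ^ 2) (γ * q ^ 2) (γ * q ^ 3) (γ ^ 2 * q ^ 2) (q ^ 2) (t ^ 2) =
      q * ((q * t)⁻¹ - γ * q * (q * t)) * forwardCoeff s (-s) (γ * q) (-γ * q) q t := by
  unfold forwardCoeff
  rw [show (1 - γ ^ 2 * q ^ 2 * (t ^ 2) ^ 2) * (1 - γ ^ 2 * q ^ 2 * q ^ 2 * (t ^ 2) ^ 2) =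
    (1 - γ * (q * t ^ 2)) * (1 + γ * (q * t ^ 2)) *
      ((1 - γ * (q ^ 2 * t ^ 2)) * (1 + γ * (q ^ 2 * t ^ 2))) by ring,
    show (1 - -γ * q * t ^ 2) * (1 - -γ * q * q * t ^ 2) =
      (1 + γ * (q * t ^ 2)) * (1 + γ * (q ^ 2 * t ^ 2)) by ring,
    show t⁻¹ - γ * q * t = (1 - γ * (q * t ^ 2)) / t by field_simp,
    show q * ((q * t)⁻¹ - γ * q * (q * t)) = (1 - γ * q ^ 3 * t ^ 2) / t by field_simp,
    div_mul_div_comm, div_mul_div_comm, div_eq_div_iff (by positivity) (by positivity)]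
  ring

theorem backwardCoeff_quadratic_odd (hq : q ≠ 0) (ht : t ≠ 0) (hγ : γ ≠ 0)
    (h1 : 1 - γ * (q * t ^ 2) ≠ 0)
    (h2 : 1 + γ * (q * t ^ 2) ≠ 0) (h3 : 1 - γ * t ^ 2 ≠ 0) (h4 : 1 + γ * t ^ 2 ≠ 0) :
    (t⁻¹ - γ * q * t) *
        backwardCoeff (s ^ 2) (γ * q ^ 2) (γ * q ^ 3) (γ ^ 2 * q ^ 2) (q ^ 2) (t ^ 2) =
      q * ((t / q)⁻¹ - γ * q * (t / q)) * backwardCoeff s (-s) (γ * q) (-γ * q) q t := by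
  unfold backwardCoeff
  rw [show γ ^ 2 * q ^ 2 * (q ^ 2 - γ ^ 2 * q ^ 2 * (t ^ 2) ^ 2) *
      (1 - γ ^ 2 * q ^ 2 * (t ^ 2) ^ 2) =
    γ ^ 2 * q ^ 4 * ((1 - γ * (q * t ^ 2)) * (1 + γ * (q * t ^ 2)) *
      ((1 - γ * t ^ 2) * (1 + γ * t ^ 2))) by ring,
    show -γ * q * (q - -γ * q * t ^ 2) * (1 - -γ * q * t ^ 2) =
      -(γ * q ^ 2) * ((1 + γ * (q * t ^ 2)) * (1 + γ * t ^ 2)) by ring,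
    show t⁻¹ - γ * q * t = (1 - γ * (q * t ^ 2)) / t by field_simp,
    show q * ((t / q)⁻¹ - γ * q * (t / q)) = q * (q - γ * t ^ 2) / t by field_simp,
    div_mul_div_comm, div_mul_div_comm, div_eq_div_iff (by positivity)
      (mul_ne_zero ht (mul_ne_zero (by simp [hq, hγ]) (by positivity)))]
  ring

/-- The gauge factor `t⁻¹ - γqt` is itself an eigenfunction of the base `q` operator: it is the case
`A = q⁻¹`, `B = s²` up to a constant. This gives the zeroth-order term produced by the conjugation.
-/
theorem coeff_sum_quadratic_odd (hq : q ≠ 0) (ht : t ≠ 0) (hγ : γ ≠ 0)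
    (h2 : 1 + γ * (q * t ^ 2) ≠ 0) (h4 : 1 + γ * t ^ 2 ≠ 0)
    (h6 : 1 + γ * (q ^ 2 * t ^ 2) ≠ 0) :
    q * ((q * t)⁻¹ - γ * q * (q * t) - (t⁻¹ - γ * q * t)) *
          forwardCoeff s (-s) (γ * q) (-γ * q) q t +
        q * ((t / q)⁻¹ - γ * q * (t / q) - (t⁻¹ - γ * q * t)) *
          backwardCoeff s (-s) (γ * q) (-γ * q) q t =
      (1 - q) * (1 - s ^ 2) * (t⁻¹ - γ * q * t) := by
  unfold forwardCoeff backwardCoeff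
  rw [show -γ * q * (q - -γ * q * t ^ 2) * (1 - -γ * q * t ^ 2) =
      -(γ * q ^ 2) * ((1 + γ * (q * t ^ 2)) * (1 + γ * t ^ 2)) by ring,
    show (1 - -γ * q * t ^ 2) * (1 - -γ * q * q * t ^ 2) =
      (1 + γ * (q * t ^ 2)) * (1 + γ * (q ^ 2 * t ^ 2)) by ring]
  generalize hd1 : 1 + γ * (q * t ^ 2) = d1 at *
  generalize hd2 : 1 + γ * t ^ 2 = d2 at *
  generalize hd3 : 1 + γ * (q ^ 2 * t ^ 2) = d3 at *
  field_simp
  rw [← hd1, ← hd2, ← hd3]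
  ring

end Coefficients

/-! ### The transformations at lattice points, for nonreal `γ` -/

section Lattice

variable {q : ℝ} {γ A B s : ℂ} {N : ℕ}

theorem one_sub_ofReal_pow_ne_zero (hq0 : 0 < q) (hq1 : q < 1) (k : ℕ) :
    1 - (q : ℂ) ^ (k + 1) ≠ 0 := by
  have : q ^ (k + 1) < 1 := pow_lt_one₀ hq0.le hq1 (by omega)
  intro h
  have h' : 1 - q ^ (k + 1) = 0 := by exact_mod_cast h
  linarith

theorem forwardCoeff_ne_zero (hγ : γ.im ≠ 0) (m : ℕ) (hs : 1 - s ^ 2 * ((q : ℂ) ^ 2) ^ m ≠ 0) :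
    forwardCoeff s (-s) (γ * q) (-γ * q) q ((q : ℂ) ^ m) ≠ 0 := by
  have hm := one_sub_mul_ofReal_ne_zero hγ
  have hp := one_add_mul_ofReal_ne_zero hγ
  have h1 := hm (q * q ^ m)
  have h2 := hp (q * q ^ m)
  have h3 := hp (q * (q ^ m) ^ 2)
  have h4 := hp (q ^ 2 * (q ^ m) ^ 2)
  push_cast at h1 h2 h3 h4
  unfold forwardCoeff
  rw [show (1 - s * (q : ℂ) ^ m) * (1 - -s * (q : ℂ) ^ m) * (1 - γ * q * (q : ℂ) ^ m) *
      (1 - -γ * q * (q : ℂ) ^ m) = (1 - s ^ 2 * ((q : ℂ) ^ 2) ^ m) *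
      ((1 - γ * (q * (q : ℂ) ^ m)) * (1 + γ * (q * (q : ℂ) ^ m))) by ring,
    show (1 - -γ * q * ((q : ℂ) ^ m) ^ 2) * (1 - -γ * q * q * ((q : ℂ) ^ m) ^ 2) =
      (1 + γ * (q * ((q : ℂ) ^ m) ^ 2)) * (1 + γ * (q ^ 2 * ((q : ℂ) ^ m) ^ 2)) by ring]
  positivity

theorem difference_latticeSum_base (hq0 : 0 < q) (hq1 : q < 1) (hγ : γ.im ≠ 0)
    (hs : ∀ k < N, 1 - s ^ 2 * ((q : ℂ) ^ 2) ^ k ≠ 0) (hAB : A * B * q = s ^ 2)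
    {m : ℕ} (hmN : m < N) :
    forwardCoeff s (-s) (γ * q) (-γ * q) q ((q : ℂ) ^ m) *
          (latticeSum N A B s (-s) (γ * q) (-γ * q) q (q * (q : ℂ) ^ m) -
            latticeSum N A B s (-s) (γ * q) (-γ * q) q ((q : ℂ) ^ m)) +
        backwardCoeff s (-s) (γ * q) (-γ * q) q ((q : ℂ) ^ m) *
          (latticeSum N A B s (-s) (γ * q) (-γ * q) q ((q : ℂ) ^ m / q) -
            latticeSum N A B s (-s) (γ * q) (-γ * q) q ((q : ℂ) ^ m)) =
      -(1 - A) * (1 - B) * latticeSum N A B s (-s) (γ * q) (-γ * q) q ((q : ℂ) ^ m) := by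
  have hq : (q : ℂ) ≠ 0 := by exact_mod_cast hq0.ne'
  have hγ0 : γ ≠ 0 := by rintro rfl; simp at hγ
  have hm := one_sub_mul_ofReal_ne_zero hγ
  have hp := one_add_mul_ofReal_ne_zero hγ
  have hs' : ∀ k < N, 1 - s * (q : ℂ) ^ k ≠ 0 ∧ 1 - -s * (q : ℂ) ^ k ≠ 0 := fun k hk => by
    rw [← mul_ne_zero_iff]
    convert hs k hk using 1
    ring
  refine difference_latticeSum N A B s (-s) (γ * q) (-γ * q) q _ hq (pow_ne_zero _ hq)
    (by simp [hq, hγ0]) ?_ ?_ ?_ (fun k hk => (hs' k hk).1) (fun k hk => (hs' k hk).2) ?_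
    (fun k _ => one_sub_ofReal_pow_ne_zero hq0 hq1 k) ?_ (latticeBasis_eq_zero hq hmN)
  · convert hp (q * (q ^ m) ^ 2) using 1; push_cast; ring
  · convert hp (q * q * (q ^ m) ^ 2) using 1; push_cast; ring
  · convert mul_ne_zero hq (hp ((q ^ m) ^ 2)) using 1; push_cast; ring
  · intro k _
    convert hm (q * q ^ k) using 1; push_cast; ring
  · linear_combination -γ * q * hAB

/-- The difference equation of a base `q²` series with lower parameters `s², b₂, b₃`. -/
theorem difference_latticeSum_sq (hq0 : 0 < q) (hq1 : q < 1) (hγ : γ.im ≠ 0) (i : ℕ)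
    (hs : ∀ k < N, 1 - s ^ 2 * ((q : ℂ) ^ 2) ^ k ≠ 0)
    (hAB : A * B * q ^ 2 = s ^ 2 * (q : ℂ) ^ (2 * i + 1))
    {m : ℕ} (hmN : m < N) :
    forwardCoeff (s ^ 2) (γ * q ^ (i + 1)) (γ * q ^ (i + 2)) (γ ^ 2 * q ^ 2) (q ^ 2)
          (((q : ℂ) ^ m) ^ 2) *
          (latticeSum N A B (s ^ 2) (γ * q ^ (i + 1)) (γ * q ^ (i + 2)) (γ ^ 2 * q ^ 2) (q ^ 2)
              ((q * (q : ℂ) ^ m) ^ 2) -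
            latticeSum N A B (s ^ 2) (γ * q ^ (i + 1)) (γ * q ^ (i + 2)) (γ ^ 2 * q ^ 2) (q ^ 2)
              (((q : ℂ) ^ m) ^ 2)) +
        backwardCoeff (s ^ 2) (γ * q ^ (i + 1)) (γ * q ^ (i + 2)) (γ ^ 2 * q ^ 2) (q ^ 2)
            (((q : ℂ) ^ m) ^ 2) *
          (latticeSum N A B (s ^ 2) (γ * q ^ (i + 1)) (γ * q ^ (i + 2)) (γ ^ 2 * q ^ 2) (q ^ 2)
              (((q : ℂ) ^ m / q) ^ 2) -
            latticeSum N A B (s ^ 2) (γ * q ^ (i + 1)) (γ * q ^ (i + 2)) (γ ^ 2 * q ^ 2) (q ^ 2)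
              (((q : ℂ) ^ m) ^ 2)) =
      -(1 - A) * (1 - B) * latticeSum N A B (s ^ 2) (γ * q ^ (i + 1)) (γ * q ^ (i + 2))
        (γ ^ 2 * q ^ 2) (q ^ 2) (((q : ℂ) ^ m) ^ 2) := by
  have hq : (q : ℂ) ≠ 0 := by exact_mod_cast hq0.ne'
  have hγ0 : γ ≠ 0 := by rintro rfl; simp at hγ
  have hm := one_sub_mul_ofReal_ne_zero hγ
  have hp := one_add_mul_ofReal_ne_zero hγ
  rw [mul_pow, div_pow]
  refine difference_latticeSum N A B (s ^ 2) (γ * q ^ (i + 1)) (γ * q ^ (i + 2)) (γ ^ 2 * q ^ 2)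
    (q ^ 2) _ (pow_ne_zero _ hq) (pow_ne_zero _ (pow_ne_zero _ hq))
    (by simp [hq, hγ0]) ?_ ?_ ?_ hs ?_ ?_
    (fun k _ => ?_) ?_ ?_
  · convert mul_ne_zero (hm (q * (q ^ m) ^ 2)) (hp (q * (q ^ m) ^ 2)) using 1; push_cast; ring
  · convert mul_ne_zero (hm (q * q * (q ^ m) ^ 2)) (hp (q * q * (q ^ m) ^ 2)) using 1
    push_cast; ring
  · convert mul_ne_zero (pow_ne_zero 2 hq)
      (mul_ne_zero (hm ((q ^ m) ^ 2)) (hp ((q ^ m) ^ 2))) using 1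
    push_cast; ring
  · intro k _
    convert hm (q ^ (i + 1) * (q ^ 2) ^ k) using 1; push_cast; ring
  · intro k _
    convert hm (q ^ (i + 2) * (q ^ 2) ^ k) using 1; push_cast; ring
  · rw [← pow_mul]
    exact one_sub_ofReal_pow_ne_zero hq0 hq1 (2 * k + 1)
  · linear_combination γ ^ 2 * q ^ 2 * hAB
  · rw [pow_right_comm]
    exact latticeBasis_eq_zero (pow_ne_zero _ hq) hmN

/-- Singh's quadratic transformation on the lattice, for nonreal `γ`. -/
theorem latticeSum_quadratic (hq0 : 0 < q) (hq1 : q < 1) (hγ : γ.im ≠ 0)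
    (hs : ∀ k < N, 1 - s ^ 2 * ((q : ℂ) ^ 2) ^ k ≠ 0) (hAB : A * B * q = s ^ 2)
    {m : ℕ} (hmN : m ≤ N) :
    latticeSum N A B s (-s) (γ * q) (-γ * q) q ((q : ℂ) ^ m) =
      latticeSum N A B (s ^ 2) (γ * q) (γ * q ^ 2) (γ ^ 2 * q ^ 2) (q ^ 2)
        (((q : ℂ) ^ m) ^ 2) := by
  have hq : (q : ℂ) ≠ 0 := by exact_mod_cast hq0.ne'
  have hγ0 : γ ≠ 0 := by rintro rfl; simp at hγ
  refine eq_on_lattice_of_difference_eq (q := q) (lam := -(1 - A) * (1 - B)) (N := N)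
    (U := forwardCoeff s (-s) (γ * q) (-γ * q) q) (V := backwardCoeff s (-s) (γ * q) (-γ * q) q)
    (f := latticeSum N A B s (-s) (γ * q) (-γ * q) q)
    (g := fun t => latticeSum N A B (s ^ 2) (γ * q) (γ * q ^ 2) (γ ^ 2 * q ^ 2) (q ^ 2) (t ^ 2))
    hq ?_ ?_ ?_ ?_ ?_ m hmN
  · exact fun k hk => forwardCoeff_ne_zero hγ k (hs k hk)
  · simp [backwardCoeff]
  · rw [one_pow, latticeSum_one _ _ _ _ _ _ _ hq, latticeSum_one _ _ _ _ _ _ _ (pow_ne_zero 2 hq)]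
  · exact fun k hk => difference_latticeSum_base hq0 hq1 hγ hs hAB hk
  · intro k hk
    have h := difference_latticeSum_sq (A := A) (B := B) hq0 hq1 hγ 0 hs
      (by linear_combination q * hAB) hk
    have hm := one_sub_mul_ofReal_ne_zero hγ
    have hp := one_add_mul_ofReal_ne_zero hγ
    have h1 := hm (q * (q ^ k) ^ 2)
    have h2 := hp (q * (q ^ k) ^ 2)
    have h3 := hm (q ^ 2 * (q ^ k) ^ 2)
    have h4 := hp (q ^ 2 * (q ^ k) ^ 2)
    have h5 := hm ((q ^ k) ^ 2)
    have h6 := hp ((q ^ k) ^ 2)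
    push_cast at h1 h2 h3 h4 h5 h6
    simp only [zero_add, pow_one] at h
    rw [forwardCoeff_quadratic h1 h2 h3 h4, backwardCoeff_quadratic hq hγ0 h1 h2 h5 h6] at h
    exact h

/-- The companion of Singh's quadratic transformation on the lattice, for nonreal `γ`. -/
theorem latticeSum_quadratic_odd (hq0 : 0 < q) (hq1 : q < 1) (hγ : γ.im ≠ 0)
    (hs : ∀ k < N, 1 - s ^ 2 * ((q : ℂ) ^ 2) ^ k ≠ 0) (hAB : A * B * q = s ^ 2)
    {m : ℕ} (hmN : m ≤ N) :
    latticeSum N A B s (-s) (γ * q) (-γ * q) q ((q : ℂ) ^ m) =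
      (((q : ℂ) ^ m)⁻¹ - γ * q * (q : ℂ) ^ m) / (1 - γ * q) *
      latticeSum N (A * q) (B * q) (s ^ 2) (γ * q ^ 2) (γ * q ^ 3) (γ ^ 2 * q ^ 2) (q ^ 2)
        (((q : ℂ) ^ m) ^ 2) := by
  have hq : (q : ℂ) ≠ 0 := by exact_mod_cast hq0.ne'
  have hγ0 : γ ≠ 0 := by rintro rfl; simp at hγ
  have hm := one_sub_mul_ofReal_ne_zero hγ
  have hp := one_add_mul_ofReal_ne_zero hγ
  refine eq_on_lattice_of_difference_eq (q := q) (lam := -(1 - A) * (1 - B)) (N := N)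
    (U := forwardCoeff s (-s) (γ * q) (-γ * q) q) (V := backwardCoeff s (-s) (γ * q) (-γ * q) q)
    (f := latticeSum N A B s (-s) (γ * q) (-γ * q) q)
    (g := fun t => (t⁻¹ - γ * q * t) / (1 - γ * q) *
      latticeSum N (A * q) (B * q) (s ^ 2) (γ * q ^ 2) (γ * q ^ 3) (γ ^ 2 * q ^ 2) (q ^ 2) (t ^ 2))
    hq ?_ ?_ ?_ ?_ ?_ m hmN
  · exact fun k hk => forwardCoeff_ne_zero hγ k (hs k hk)
  · simp [backwardCoeff]
  · rw [one_pow, latticeSum_one _ _ _ _ _ _ _ hq, latticeSum_one _ _ _ _ _ _ _ (pow_ne_zero 2 hq)]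
    rw [inv_one, mul_one, mul_one, div_self (hm q)]
  · exact fun k hk => difference_latticeSum_base hq0 hq1 hγ hs hAB hk
  · intro k hk
    have h := difference_latticeSum_sq (A := A * q) (B := B * q) hq0 hq1 hγ 1 hs
      (by linear_combination q ^ 3 * hAB) hk
    have h1 := hm (q * (q ^ k) ^ 2)
    have h2 := hp (q * (q ^ k) ^ 2)
    have h3 := hm (q ^ 2 * (q ^ k) ^ 2)
    have h4 := hp (q ^ 2 * (q ^ k) ^ 2)
    have h5 := hm ((q ^ k) ^ 2)
    have h6 := hp ((q ^ k) ^ 2)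
    push_cast at h1 h2 h3 h4 h5 h6
    have ht : (q : ℂ) ^ k ≠ 0 := pow_ne_zero _ hq
    have hF := forwardCoeff_quadratic_odd (s := s) hq ht h1 h2 h3 h4
    have hB := backwardCoeff_quadratic_odd (s := s) hq ht hγ0 h1 h2 h5 h6
    have hC := coeff_sum_quadratic_odd (s := s) hq ht hγ0 h2 h6 h4
    simp only [Nat.reduceAdd] at h
    simp only [div_mul_eq_mul_div _ (1 - γ * (q : ℂ)), ← sub_div, ← mul_div_assoc, ← add_div]
    congr 1
    -- The gauge identities `hF`, `hB`, `hC` carry a factor `q`.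
    apply mul_left_cancel₀ hq
    generalize latticeSum N (A * q) (B * q) (s ^ 2) (γ * q ^ 2) (γ * q ^ 3) (γ ^ 2 * q ^ 2) (q ^ 2)
      = H at *
    generalize forwardCoeff (s ^ 2) (γ * q ^ 2) (γ * q ^ 3) (γ ^ 2 * q ^ 2) (q ^ 2) _ = F₂ at *
    generalize backwardCoeff (s ^ 2) (γ * q ^ 2) (γ * q ^ 3) (γ ^ 2 * q ^ 2) (q ^ 2) _ = B₂ at *
    generalize forwardCoeff s (-s) (γ * q) (-γ * q) q _ = F at *
    generalize backwardCoeff s (-s) (γ * q) (-γ * q) q _ = B₁ at *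
    generalize (q : ℂ) ^ k = t at *
    -- The terms in `hC` and `hAB` reconcile the eigenvalues: `(1 - Aq)(1 - Bq) - q(1 - A)(1 - B) =
    -- (1 - q)(1 - ABq)` and `ABq = s²`.
    linear_combination (t⁻¹ - γ * q * t) * h - (H ((q * t) ^ 2) - H (t ^ 2)) * hF -
      (H ((t / q) ^ 2) - H (t ^ 2)) * hB + H (t ^ 2) * hC +
      (1 - q) * (t⁻¹ - γ * q * t) * H (t ^ 2) * hAB

end Lattice

/-! ### From lattice sums to `q`-Racah polynomials -/

theorem latticeSum_swap_lower (N : ℕ) (A B b₁ b₂ b₃ e q t : ℂ) :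
    latticeSum N A B b₁ b₂ b₃ e q t = latticeSum N A B b₁ b₃ b₂ e q t := by
  refine Finset.sum_congr rfl fun k _ => ?_
  rw [latticeCoeff, latticeCoeff, mul_right_comm (qPoch b₁ q k)]

theorem qHyp43_swap_upper (a₁ a₂ a₃ a₄ b₁ b₂ b₃ q z : ℂ) :
    qHyp43 a₁ a₂ a₃ a₄ b₁ b₂ b₃ q z = qHyp43 a₂ a₁ a₃ a₄ b₁ b₂ b₃ q z := by
  refine tsum_congr fun k => ?_
  rw [mul_comm (qPoch a₁ q k)]

theorem qHyp43_swap_lower (a₁ a₂ a₃ a₄ b₁ b₂ b₃ q z : ℂ) :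
    qHyp43 a₁ a₂ a₃ a₄ b₁ b₂ b₃ q z = qHyp43 a₁ a₂ a₃ a₄ b₁ b₃ b₂ q z := by
  refine tsum_congr fun k => ?_
  rw [mul_right_comm (qPoch b₁ q k)]

/-- Truncation at `M` and at `N` give the same value: beyond `M` the factor `(q^{-M}; q)_k`
vanishes, and beyond `N ≥ m` the basis function vanishes at `q^m`. Hence no bound on `M` is needed.
-/
theorem qRacah_eq_latticeSum (M : ℕ) {N m : ℕ} (α β γ δ : ℂ) {q : ℂ} (hq : q ≠ 0) (hm : m ≤ N) :
    qRacah M ((q ^ m)⁻¹ + γ * δ * q * q ^ m) α β γ δ q =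
      latticeSum N (q ^ (-(M : ℤ))) (α * β * q ^ (M + 1)) (α * q) (β * δ * q) (γ * q)
        (γ * δ * q) q (q ^ m) := by
  have hB : ∀ k, (∏ j ∈ Finset.range k,
      (1 - ((q ^ m)⁻¹ + γ * δ * q * q ^ m) * q ^ j + γ * δ * q ^ (2 * j + 1))) =
      latticeBasis (γ * δ * q) q k (q ^ m) := fun k => by
    rw [latticeBasis, qPoch, qPoch, ← Finset.prod_mul_distrib]
    refine Finset.prod_congr rfl fun j _ => ?_
    have : (q ^ m)⁻¹ * q ^ m = 1 := inv_mul_cancel₀ (pow_ne_zero _ hq)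
    linear_combination -γ * δ * q ^ (2 * j + 1) * this
  have hA : ∀ k, M < k → qPoch (q ^ (-(M : ℤ))) q k = 0 := fun k hk =>
    qPoch_eq_zero hk (by
      rw [zpow_neg, zpow_natCast, inv_mul_cancel₀ (pow_ne_zero _ hq), sub_self])
  set F : ℕ → ℂ := fun k => latticeCoeff (q ^ (-(M : ℤ))) (α * β * q ^ (M + 1)) (α * q)
    (β * δ * q) (γ * q) q k * latticeBasis (γ * δ * q) q k (q ^ m) with hF
  have h1 : qRacah M ((q ^ m)⁻¹ + γ * δ * q * q ^ m) α β γ δ q =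
      ∑ k ∈ Finset.range (M + 1), F k := by
    refine Finset.sum_congr rfl fun k _ => ?_
    simp only [hB, hF, latticeCoeff]
    ring
  have hext : ∀ K, K ≤ M + N → (∀ k, K < k → F k = 0) →
      ∑ k ∈ Finset.range (K + 1), F k = ∑ k ∈ Finset.range (M + N + 1), F k := fun K hK h =>
    Finset.sum_subset (Finset.range_mono (by omega)) fun k _ hk => h k (by simpa using hk)
  rw [h1, hext M (by omega) fun k hk => by
      simp only [hF, latticeCoeff, hA k hk, zero_mul, zero_div], latticeSum,
    hext N (by omega) fun k hk => by
      simp only [hF]; rw [latticeBasis_eq_zero hq (by omega), mul_zero]]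

section ZPow

variable {q : ℂ}

theorem zpow_parameter_base (hq : q ≠ 0) (N : ℕ) : q ^ (-(N : ℤ) - 1) * q = q ^ (-(N : ℤ)) := by
  rw [← zpow_add_one₀ hq, sub_add_cancel]

theorem zpow_parameter_sq (hq : q ≠ 0) (N : ℕ) : q ^ (-2 * (N : ℤ) - 2) * q ^ 2 = q ^ (-2 * (N : ℤ)) := by
  rw [← zpow_natCast q 2, ← zpow_add₀ hq]
  congr 1
  push_cast; ring

theorem zpow_upper_base (hq : q ≠ 0) (N M : ℕ) :
    q ^ (-(N : ℤ) - 1) * q ^ (-(N : ℤ) - 1) * q ^ (M + 1) = q ^ ((M : ℤ) - 2 * N - 1) := by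
  rw [← zpow_natCast q (M + 1), ← zpow_add₀ hq, ← zpow_add₀ hq]
  congr 1
  push_cast; ring

theorem zpow_upper_sq_even (hq : q ≠ 0) (N n : ℕ) :
    q ^ (-2 * (N : ℤ) - 2) * q⁻¹ * (q ^ 2) ^ (n + 1) = q ^ (2 * (n : ℤ) - 2 * N - 1) := by
  rw [← pow_mul, ← zpow_natCast q (2 * (n + 1)), ← zpow_sub_one₀ hq, ← zpow_add₀ hq]
  congr 1
  push_cast; ring

theorem zpow_upper_sq_odd (hq : q ≠ 0) (N n : ℕ) :
    q ^ (-2 * (N : ℤ) - 2) * q * (q ^ 2) ^ (n + 1) = q ^ (2 * (n : ℤ) - 2 * N + 1) := by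
  rw [← pow_mul, ← zpow_natCast q (2 * (n + 1)), ← zpow_add_one₀ hq, ← zpow_add₀ hq]
  congr 1
  push_cast; ring

theorem zpow_terminating_sq (n : ℕ) : (q ^ 2) ^ (-(n : ℤ)) = q ^ (-2 * (n : ℤ)) := by
  rw [← zpow_natCast q 2, ← zpow_mul]
  congr 1
  push_cast; ring

end ZPow

section Generic

variable {q : ℝ} {γ : ℂ} {N : ℕ}

theorem one_sub_zpow_ne_zero (hq0 : 0 < q) (hq1 : q < 1) {k : ℕ} (hk : k < N) :
    1 - ((q : ℂ) ^ (-(N : ℤ))) ^ 2 * ((q : ℂ) ^ 2) ^ k ≠ 0 := by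
  have hq : (q : ℂ) ≠ 0 := by exact_mod_cast hq0.ne'
  obtain ⟨j, rfl⟩ : ∃ j, N = k + j + 1 := ⟨N - k - 1, by omega⟩
  have h := one_sub_ofReal_pow_ne_zero hq0 hq1 (2 * j + 1)
  intro h0
  apply h
  rw [zpow_neg, zpow_natCast] at h0
  have hk : (q : ℂ) ^ (k + j + 1) ≠ 0 := pow_ne_zero _ hq
  field_simp at h0
  have hk' : (q : ℂ) ^ (2 * k) ≠ 0 := pow_ne_zero _ hq
  have h2 : (q : ℂ) ^ (2 * k) * (q ^ (2 * j + 1 + 1) - 1) = 0 := by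
    linear_combination h0
  have := (mul_eq_zero.mp h2).resolve_left hk'
  linear_combination -this

theorem zpow_neg_sq (z : ℂ) (N : ℕ) : z ^ (-2 * (N : ℤ)) = (z ^ (-(N : ℤ))) ^ 2 := by
  rw [← zpow_natCast (z ^ (-(N : ℤ))) 2, ← zpow_mul]
  congr 1
  push_cast; ring

theorem qRacah_quadratic_lattice_generic (hq0 : 0 < q) (hq1 : q < 1) (hγ : γ.im ≠ 0) (n : ℕ)
    {m : ℕ} (hm : m ≤ N) :
    qRacah n ((((q : ℂ) ^ m)⁻¹ - γ * q * (q : ℂ) ^ m) ^ 2 + 2 * γ * q)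
        ((q : ℂ) ^ (-2 * (N : ℤ) - 2)) ((q : ℂ)⁻¹) γ γ ((q : ℂ) ^ 2) =
      qRacah (2 * n) (((q : ℂ) ^ m)⁻¹ - γ * q * (q : ℂ) ^ m) ((q : ℂ) ^ (-(N : ℤ) - 1))
        ((q : ℂ) ^ (-(N : ℤ) - 1)) γ (-1) q := by
  have hq : (q : ℂ) ≠ 0 := by exact_mod_cast hq0.ne'
  have ht : ((q : ℂ) ^ m)⁻¹ * q ^ m = 1 := inv_mul_cancel₀ (pow_ne_zero _ hq)
  have e1 : (((q : ℂ) ^ m)⁻¹ - γ * q * (q : ℂ) ^ m) ^ 2 + 2 * γ * q =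
      (((q : ℂ) ^ 2) ^ m)⁻¹ + γ * γ * q ^ 2 * ((q : ℂ) ^ 2) ^ m := by
    rw [pow_right_comm, ← inv_pow]
    linear_combination -2 * γ * q * ht
  have e2 : ((q : ℂ) ^ m)⁻¹ - γ * q * (q : ℂ) ^ m =
      ((q : ℂ) ^ m)⁻¹ + γ * (-1) * q * (q : ℂ) ^ m := by ring
  rw [e1, e2, qRacah_eq_latticeSum n _ _ _ _ (pow_ne_zero 2 hq) hm,
    qRacah_eq_latticeSum (2 * n) _ _ _ _ hq hm]
  simp only [zpow_parameter_base hq, zpow_parameter_sq hq, zpow_upper_base hq,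
    zpow_upper_sq_even hq, zpow_terminating_sq]
  have key := latticeSum_quadratic (A := (q : ℂ) ^ (-2 * (n : ℤ)))
    (B := (q : ℂ) ^ (2 * (n : ℤ) - 2 * N - 1)) (s := (q : ℂ) ^ (-(N : ℤ))) hq0 hq1 hγ
    (fun k hk => one_sub_zpow_ne_zero hq0 hq1 hk) (by
      rw [← zpow_neg_sq, ← zpow_add₀ hq, ← zpow_add_one₀ hq]; congr 1; ring) hm
  rw [zpow_neg_sq _ N, pow_right_comm (q : ℂ) 2 m,
    show (q : ℂ)⁻¹ * γ * q ^ 2 = γ * q by field_simp,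
    show γ * γ * (q : ℂ) ^ 2 = γ ^ 2 * q ^ 2 by ring, ← key]
  congr 1
  · rw [mul_neg_one, neg_mul, zpow_parameter_base hq]
  · ring

theorem qRacah_quadratic_odd_lattice_generic (hq0 : 0 < q) (hq1 : q < 1) (hγ : γ.im ≠ 0) (n : ℕ)
    {m : ℕ} (hm : m ≤ N) :
    (((q : ℂ) ^ m)⁻¹ - γ * q * (q : ℂ) ^ m) / (1 - γ * q) *
      qRacah n ((((q : ℂ) ^ m)⁻¹ - γ * q * (q : ℂ) ^ m) ^ 2 + 2 * γ * q)
        ((q : ℂ) ^ (-2 * (N : ℤ) - 2)) q γ γ ((q : ℂ) ^ 2) =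
      qRacah (2 * n + 1) (((q : ℂ) ^ m)⁻¹ - γ * q * (q : ℂ) ^ m) ((q : ℂ) ^ (-(N : ℤ) - 1))
        ((q : ℂ) ^ (-(N : ℤ) - 1)) γ (-1) q := by
  have hq : (q : ℂ) ≠ 0 := by exact_mod_cast hq0.ne'
  have ht : ((q : ℂ) ^ m)⁻¹ * q ^ m = 1 := inv_mul_cancel₀ (pow_ne_zero _ hq)
  have e1 : (((q : ℂ) ^ m)⁻¹ - γ * q * (q : ℂ) ^ m) ^ 2 + 2 * γ * q =
      (((q : ℂ) ^ 2) ^ m)⁻¹ + γ * γ * q ^ 2 * ((q : ℂ) ^ 2) ^ m := by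
    rw [pow_right_comm, ← inv_pow]
    linear_combination -2 * γ * q * ht
  have e2 : qRacah (2 * n + 1) (((q : ℂ) ^ m)⁻¹ - γ * q * (q : ℂ) ^ m) =
      qRacah (2 * n + 1) (((q : ℂ) ^ m)⁻¹ + γ * (-1) * q * (q : ℂ) ^ m) := by congr 1; ring
  rw [e1, e2, qRacah_eq_latticeSum n _ _ _ _ (pow_ne_zero 2 hq) hm,
    qRacah_eq_latticeSum (2 * n + 1) _ _ _ _ hq hm, latticeSum_swap_lower N ((_ ^ 2) ^ _)]
  simp only [zpow_parameter_base hq, zpow_parameter_sq hq, zpow_upper_base hq,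
    zpow_upper_sq_odd hq, zpow_terminating_sq]
  have key := latticeSum_quadratic_odd (A := (q : ℂ) ^ (-2 * (n : ℤ) - 1))
    (B := (q : ℂ) ^ (2 * (n : ℤ) - 2 * N)) (s := (q : ℂ) ^ (-(N : ℤ))) hq0 hq1 hγ
    (fun k hk => one_sub_zpow_ne_zero hq0 hq1 hk) (by
      rw [← zpow_neg_sq, ← zpow_add₀ hq, ← zpow_add_one₀ hq]; congr 1; ring) hm
  rw [← zpow_add_one₀ hq, ← zpow_add_one₀ hq, sub_add_cancel] at key
  rw [zpow_neg_sq _ N, pow_right_comm (q : ℂ) 2 m,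
    show (q : ℂ) * γ * q ^ 2 = γ * q ^ 3 by ring,
    show γ * γ * (q : ℂ) ^ 2 = γ ^ 2 * q ^ 2 by ring, ← key]
  congr 1
  · congr 1; push_cast; ring
  · congr 1; push_cast; ring
  · rw [mul_neg_one, neg_mul, zpow_parameter_base hq]
  · ring

end Generic

/-! ### Polynomials in `y` and their degrees -/

/-- The coefficient of `∏_{j < k} (1 - y q^j + γδ q^{2j+1})` in `qRacah n y α β γ δ q`. -/
def qRacahCoeff (n : ℕ) (α β γ δ q : ℂ) (k : ℕ) : ℂ :=
  latticeCoeff (q ^ (-(n : ℤ))) (α * β * q ^ (n + 1)) (α * q) (β * δ * q) (γ * q) q k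

open Polynomial in
/-- The polynomial in `y` underlying `qRacah`. -/
def qRacahPoly (n : ℕ) (α β γ δ q : ℂ) : ℂ[X] :=
  ∑ k ∈ Finset.range (n + 1), C (qRacahCoeff n α β γ δ q k) *
    ∏ j ∈ Finset.range k, (C (-q ^ j) * X + C (1 + γ * δ * q ^ (2 * j + 1)))

section Polynomial

open Polynomial

variable (n : ℕ) (α β γ δ q : ℂ)

theorem eval_qRacahPoly (y : ℂ) :
    (qRacahPoly n α β γ δ q).eval y = qRacah n y α β γ δ q := by
  simp only [qRacahPoly, eval_finsetSum, eval_mul, eval_C, eval_prod, eval_add, eval_X, qRacah,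
    qRacahCoeff, latticeCoeff]
  refine Finset.sum_congr rfl fun k _ => ?_
  rw [show (∏ j ∈ Finset.range k, (-q ^ j * y + (1 + γ * δ * q ^ (2 * j + 1)))) =
    ∏ j ∈ Finset.range k, (1 - y * q ^ j + γ * δ * q ^ (2 * j + 1)) from
      Finset.prod_congr rfl fun j _ => by ring]
  ring

theorem natDegree_prod_linear (hq : q ≠ 0) (k : ℕ) :
    (∏ j ∈ Finset.range k,
      (C (-q ^ j) * X + C (1 + γ * δ * q ^ (2 * j + 1)) : ℂ[X])).natDegree = k := by
  have h : ∀ j, (C (-q ^ j) * X + C (1 + γ * δ * q ^ (2 * j + 1)) : ℂ[X]).natDegree = 1 :=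
    fun j => natDegree_linear (neg_ne_zero.mpr (pow_ne_zero _ hq))
  rw [natDegree_prod _ _ fun j _ h0 => by have := h j; rw [h0] at this; simp at this]
  simp only [h, Finset.sum_const, Finset.card_range, smul_eq_mul, mul_one]

theorem natDegree_qRacahPoly_le (hq : q ≠ 0) : (qRacahPoly n α β γ δ q).natDegree ≤ n := by
  refine natDegree_sum_le_of_forall_le _ _ fun k hk => ?_
  refine (natDegree_C_mul_le _ _).trans ?_
  rw [natDegree_prod_linear γ δ q hq]
  exact Nat.lt_succ_iff.mp (Finset.mem_range.mp hk)

theorem natDegree_qRacahPoly (hq : q ≠ 0) (h : qRacahCoeff n α β γ δ q n ≠ 0) :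
    (qRacahPoly n α β γ δ q).natDegree = n := by
  have htop : (C (qRacahCoeff n α β γ δ q n) * ∏ j ∈ Finset.range n,
      (C (-q ^ j) * X + C (1 + γ * δ * q ^ (2 * j + 1)) : ℂ[X])).natDegree = n := by
    rw [natDegree_C_mul h, natDegree_prod_linear γ δ q hq]
  rcases n with _ | n
  · exact Nat.le_zero.mp (natDegree_qRacahPoly_le 0 α β γ δ q hq)
  · rw [qRacahPoly, Finset.sum_range_succ, natDegree_add_eq_right_of_natDegree_lt, htop]
    rw [htop, Nat.lt_succ_iff]
    refine natDegree_sum_le_of_forall_le _ _ fun k hk => ?_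
    refine (natDegree_C_mul_le _ _).trans ?_
    rw [natDegree_prod_linear γ δ q hq]
    exact Nat.lt_succ_iff.mp (Finset.mem_range.mp hk)

theorem natDegree_comp_quadratic (p : ℂ[X]) (c : ℂ) :
    (p.comp (X ^ 2 + C c)).natDegree = p.natDegree * 2 := by
  rw [natDegree_comp, natDegree_X_pow_add_C]

theorem finite_setOf_eval_eq {p r : ℂ[X]} (h : r.natDegree < p.natDegree) :
    {y : ℂ | p.eval y = r.eval y}.Finite := by
  have hne : p - r ≠ 0 := fun h0 => by
    rw [sub_eq_zero.mp h0] at h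
    exact lt_irrefl _ h
  refine (finite_setOfPred_isRoot hne).subset fun y hy => ?_
  simpa [IsRoot, sub_eq_zero] using hy

end Polynomial

/-! ### Continuity in `γ` -/

theorem eq_of_eq_on_nonreal {f g : ℂ → ℂ} {z : ℂ} (hf : ContinuousAt f z) (hg : ContinuousAt g z)
    (h : ∀ w : ℂ, w.im ≠ 0 → f w = g w) : f z = g z := by
  have hseq : Filter.Tendsto (fun ε : ℝ => z + ε * Complex.I) (nhdsWithin 0 {0}ᶜ) (nhds z) := by
    have : Continuous (fun ε : ℝ => z + ε * Complex.I) := by fun_prop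
    have h0 := this.tendsto 0
    simp only [Complex.ofReal_zero, zero_mul, add_zero] at h0
    exact h0.mono_left nhdsWithin_le_nhds
  refine tendsto_nhds_unique_of_frequently_eq (hf.tendsto.comp hseq) (hg.tendsto.comp hseq) ?_
  apply Filter.Eventually.frequently
  -- On the vertical line through `z`, only `ε = -Im z` gives a real point; for real `z` this is the
  -- excluded `ε = 0`.
  have hne : ∀ᶠ ε : ℝ in nhdsWithin 0 {0}ᶜ, ε ≠ -z.im := by
    by_cases hz : z.im = 0
    · rw [hz, neg_zero]
      exact eventually_mem_nhdsWithin
    · exact nhdsWithin_le_nhds (isOpen_ne.mem_nhds (by simpa [eq_comm] using hz))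
  filter_upwards [hne] with ε hε
  refine h _ ?_
  simp only [Complex.add_im, Complex.mul_im, Complex.ofReal_re, Complex.I_im, Complex.ofReal_im,
    Complex.I_re]
  intro h0
  apply hε
  linarith

theorem continuousAt_qPoch_comp {f : ℂ → ℂ} {z : ℂ} (hf : ContinuousAt f z) (q : ℂ) (k : ℕ) :
    ContinuousAt (fun w => qPoch (f w) q k) z := by
  unfold qPoch
  fun_prop

/-- The factor `(αq; q)_k` does not depend on `w`, so it may vanish. For the factor with `β δ w q`,
continuity of the inverse is assumed rather than nonvanishing, which makes constant `δ` immediate.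
-/
theorem continuousAt_qRacah {n : ℕ} {α β q z : ℂ} {Y δ : ℂ → ℂ} (hY : ContinuousAt Y z)
    (hδ : ContinuousAt δ z) (h3 : ∀ k ≤ n, qPoch (z * q) q k ≠ 0)
    (h2 : ∀ k ≤ n, ContinuousAt (fun w => (qPoch (β * δ w * q) q k)⁻¹) z) :
    ContinuousAt (fun w => qRacah n (Y w) α β w (δ w) q) z := by
  unfold qRacah
  refine tendsto_finsetSum _ fun k hk => ?_
  have hk : k ≤ n := Nat.lt_succ_iff.mp (Finset.mem_range.mp hk)
  have hc2 := h2 k hk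
  have hc3 : ContinuousAt (fun w => (qPoch (w * q) q k)⁻¹) z :=
    (continuousAt_qPoch_comp (by fun_prop) q k).inv₀ (h3 k hk)
  simp only [div_eq_mul_inv, mul_inv]
  exact ContinuousAt.mul (ContinuousAt.mul (by fun_prop) (by fun_prop)) (by fun_prop)

/-! ### Identities in `y`, all admissible `γ`, and finiteness -/

section Transformations

variable {q : ℝ} {γ : ℂ} {N n : ℕ}

/-- The imaginary part is `-Im γ · q^{m+1}`, strictly monotone in `m`. -/
theorem lattice_injective (hq0 : 0 < q) (hq1 : q < 1) (hγ : γ.im ≠ 0) :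
    Function.Injective fun m : Fin (N + 1) => ((q : ℂ) ^ (m : ℕ))⁻¹ - γ * q * (q : ℂ) ^ (m : ℕ) := by
  intro m l h
  have him := congrArg Complex.im h
  simp only [← Complex.ofReal_pow, ← Complex.ofReal_inv, mul_assoc, ← Complex.ofReal_mul,
    Complex.sub_im, Complex.ofReal_im, Complex.im_mul_ofReal, zero_sub, neg_inj] at him
  have h1 := mul_left_cancel₀ hq0.ne' (mul_left_cancel₀ hγ him)
  exact Fin.ext (pow_right_injective₀ hq0 hq1.ne h1)

open Polynomial in
theorem qRacah_quadratic_generic (hq0 : 0 < q) (hq1 : q < 1) (hγ : γ.im ≠ 0) (hn : 2 * n ≤ N)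
    (y : ℂ) :
    qRacah n (y ^ 2 + 2 * γ * q) ((q : ℂ) ^ (-2 * (N : ℤ) - 2)) ((q : ℂ)⁻¹) γ γ ((q : ℂ) ^ 2) =
      qRacah (2 * n) y ((q : ℂ) ^ (-(N : ℤ) - 1)) ((q : ℂ) ^ (-(N : ℤ) - 1)) γ (-1) q := by
  have hq : (q : ℂ) ≠ 0 := by exact_mod_cast hq0.ne'
  have h := eq_of_natDegree_lt_card_of_eval_eq
    ((qRacahPoly n ((q : ℂ) ^ (-2 * (N : ℤ) - 2)) ((q : ℂ)⁻¹) γ γ ((q : ℂ) ^ 2)).comp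
      (X ^ 2 + C (2 * γ * q)))
    (qRacahPoly (2 * n) ((q : ℂ) ^ (-(N : ℤ) - 1)) ((q : ℂ) ^ (-(N : ℤ) - 1)) γ (-1) q)
    (lattice_injective (N := N) hq0 hq1 hγ) (fun m => by
      simpa [eval_comp, eval_qRacahPoly] using
        qRacah_quadratic_lattice_generic hq0 hq1 hγ n (Nat.lt_succ_iff.mp m.2)) (by
      rw [natDegree_comp_quadratic, Fintype.card_fin, max_lt_iff]
      have h1 := natDegree_qRacahPoly_le n ((q : ℂ) ^ (-2 * (N : ℤ) - 2)) ((q : ℂ)⁻¹) γ γ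
        ((q : ℂ) ^ 2) (pow_ne_zero 2 hq)
      have h2 := natDegree_qRacahPoly_le (2 * n) ((q : ℂ) ^ (-(N : ℤ) - 1))
        ((q : ℂ) ^ (-(N : ℤ) - 1)) γ (-1) q hq
      omega)
  simpa [eval_comp, eval_qRacahPoly] using congrArg (eval y) h

open Polynomial in
theorem qRacah_quadratic_odd_generic (hq0 : 0 < q) (hq1 : q < 1) (hγ : γ.im ≠ 0)
    (hn : 2 * n + 1 ≤ N) (y : ℂ) :
    y / (1 - γ * q) *
        qRacah n (y ^ 2 + 2 * γ * q) ((q : ℂ) ^ (-2 * (N : ℤ) - 2)) q γ γ ((q : ℂ) ^ 2) =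
      qRacah (2 * n + 1) y ((q : ℂ) ^ (-(N : ℤ) - 1)) ((q : ℂ) ^ (-(N : ℤ) - 1)) γ (-1) q := by
  have hq : (q : ℂ) ≠ 0 := by exact_mod_cast hq0.ne'
  have h := eq_of_natDegree_lt_card_of_eval_eq
    (C (1 - γ * q)⁻¹ * (X *
      (qRacahPoly n ((q : ℂ) ^ (-2 * (N : ℤ) - 2)) q γ γ ((q : ℂ) ^ 2)).comp
      (X ^ 2 + C (2 * γ * q))))
    (qRacahPoly (2 * n + 1) ((q : ℂ) ^ (-(N : ℤ) - 1)) ((q : ℂ) ^ (-(N : ℤ) - 1)) γ (-1) q)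
    (lattice_injective (N := N) hq0 hq1 hγ) (fun m => by
      simp only [eval_mul, eval_C, eval_comp, eval_add, eval_pow, eval_X, eval_qRacahPoly]
      rw [← qRacah_quadratic_odd_lattice_generic hq0 hq1 hγ n (Nat.lt_succ_iff.mp m.2)]
      ring) (by
      rw [Fintype.card_fin, max_lt_iff]
      have h1 := natDegree_qRacahPoly_le n ((q : ℂ) ^ (-2 * (N : ℤ) - 2)) q γ γ
        ((q : ℂ) ^ 2) (pow_ne_zero 2 hq)
      have h2 := natDegree_qRacahPoly_le (2 * n + 1) ((q : ℂ) ^ (-(N : ℤ) - 1))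
        ((q : ℂ) ^ (-(N : ℤ) - 1)) γ (-1) q hq
      have h3 := natDegree_C_mul_le (1 - γ * q)⁻¹ (X *
        (qRacahPoly n ((q : ℂ) ^ (-2 * (N : ℤ) - 2)) q γ γ ((q : ℂ) ^ 2)).comp
        (X ^ 2 + C (2 * γ * q)))
      have h4 := natDegree_mul_le (p := (X : ℂ[X])) (q :=
        (qRacahPoly n ((q : ℂ) ^ (-2 * (N : ℤ) - 2)) q γ γ ((q : ℂ) ^ 2)).comp
        (X ^ 2 + C (2 * γ * q)))
      rw [natDegree_comp_quadratic, natDegree_X] at h4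
      omega)
  have h' := congrArg (eval y) h
  simp only [eval_mul, eval_C, eval_comp, eval_add, eval_pow, eval_X, eval_qRacahPoly] at h'
  rw [← h']
  ring

theorem qPoch_mul_pow_ne_zero {M p i k : ℕ} (h : ∀ j ∈ Finset.Icc 1 M, γ * (q : ℂ) ^ j ≠ 1)
    (hi : 1 ≤ i) (hk : i + p * (k - 1) ≤ M ∨ k = 0) :
    qPoch (γ * (q : ℂ) ^ i) ((q : ℂ) ^ p) k ≠ 0 := by
  refine qPoch_ne_zero fun j hj => ?_
  rw [mul_assoc, ← pow_mul, ← pow_add, sub_ne_zero]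
  have : p * j ≤ p * (k - 1) := Nat.mul_le_mul_left _ (by omega)
  exact (h _ (Finset.mem_Icc.mpr ⟨by omega, by omega⟩)).symm

/-- Continuity in `γ` of the base `q` side, along a curve `Y` of arguments. -/
theorem continuousAt_qRacah_base {M : ℕ} {α β : ℂ} {Y : ℂ → ℂ}
    (h : ∀ j ∈ Finset.Icc 1 M, γ * (q : ℂ) ^ j ≠ 1) (hY : ContinuousAt Y γ) :
    ContinuousAt (fun w => qRacah M (Y w) α β w (-1) q) γ := by
  refine continuousAt_qRacah hY continuousAt_const (fun k hk => ?_) fun k _ => continuousAt_const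
  have := qPoch_mul_pow_ne_zero (i := 1) (p := 1) (k := k) h le_rfl (by omega)
  simpa using this

/-- Continuity in `γ` of the base `q²` side, along a curve `Y` of arguments. -/
theorem continuousAt_qRacah_sq {M i : ℕ} {α β : ℂ} {Y : ℂ → ℂ}
    (h : ∀ j ∈ Finset.Icc 1 M, γ * (q : ℂ) ^ j ≠ 1) (hn : 2 * n ≤ M) (hi : 1 ≤ i)
    (hin : 2 * n + i ≤ M + 2) (hβ : β * (q : ℂ) ^ 2 = (q : ℂ) ^ i) (hY : ContinuousAt Y γ) :
    ContinuousAt (fun w => qRacah n (Y w) α β w w ((q : ℂ) ^ 2)) γ := by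
  refine continuousAt_qRacah hY continuousAt_id (fun k hk => ?_) fun k hk => ?_
  · exact qPoch_mul_pow_ne_zero h (by omega) (by omega)
  · refine (continuousAt_qPoch_comp (by fun_prop) _ k).inv₀ ?_
    rw [mul_right_comm, hβ, mul_comm]
    exact qPoch_mul_pow_ne_zero h (by omega) (by omega)

/-- The curve `Y` serves both uses: constant for a fixed `y`, and `w ↦ q^{-m} - w q^{m+1}` for a
lattice point, which moves with the parameter. -/
theorem qRacah_quadratic_of_generic (hq0 : 0 < q)
    (h : ∀ j ∈ Finset.Icc 1 (2 * n), γ * (q : ℂ) ^ j ≠ 1) {Y : ℂ → ℂ} (hY : ContinuousAt Y γ)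
    (hgen : ∀ w : ℂ, w.im ≠ 0 →
      qRacah n (Y w ^ 2 + 2 * w * q) ((q : ℂ) ^ (-2 * (N : ℤ) - 2)) ((q : ℂ)⁻¹) w w
          ((q : ℂ) ^ 2) =
        qRacah (2 * n) (Y w) ((q : ℂ) ^ (-(N : ℤ) - 1)) ((q : ℂ) ^ (-(N : ℤ) - 1)) w (-1) q) :
    qRacah n (Y γ ^ 2 + 2 * γ * q) ((q : ℂ) ^ (-2 * (N : ℤ) - 2)) ((q : ℂ)⁻¹) γ γ
        ((q : ℂ) ^ 2) =
      qRacah (2 * n) (Y γ) ((q : ℂ) ^ (-(N : ℤ) - 1)) ((q : ℂ) ^ (-(N : ℤ) - 1)) γ (-1) q := by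
  have hq : (q : ℂ) ≠ 0 := by exact_mod_cast hq0.ne'
  refine eq_of_eq_on_nonreal (z := γ)
    (f := fun w => qRacah n (Y w ^ 2 + 2 * w * q) ((q : ℂ) ^ (-2 * (N : ℤ) - 2)) ((q : ℂ)⁻¹) w w
      ((q : ℂ) ^ 2))
    (g := fun w => qRacah (2 * n) (Y w) ((q : ℂ) ^ (-(N : ℤ) - 1)) ((q : ℂ) ^ (-(N : ℤ) - 1))
      w (-1) q) ?_ (continuousAt_qRacah_base h hY) hgen
  exact continuousAt_qRacah_sq (i := 1) h le_rfl le_rfl (by omega) (by field_simp)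
    (Y := fun w => Y w ^ 2 + 2 * w * q) (by fun_prop)

theorem qRacah_quadratic_odd_of_generic
    (h : ∀ j ∈ Finset.Icc 1 (2 * n + 1), γ * (q : ℂ) ^ j ≠ 1) {Y : ℂ → ℂ}
    (hY : ContinuousAt Y γ)
    (hgen : ∀ w : ℂ, w.im ≠ 0 →
      Y w / (1 - w * q) *
        qRacah n (Y w ^ 2 + 2 * w * q) ((q : ℂ) ^ (-2 * (N : ℤ) - 2)) q w w ((q : ℂ) ^ 2) =
        qRacah (2 * n + 1) (Y w) ((q : ℂ) ^ (-(N : ℤ) - 1)) ((q : ℂ) ^ (-(N : ℤ) - 1))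
          w (-1) q) :
    Y γ / (1 - γ * q) *
        qRacah n (Y γ ^ 2 + 2 * γ * q) ((q : ℂ) ^ (-2 * (N : ℤ) - 2)) q γ γ ((q : ℂ) ^ 2) =
      qRacah (2 * n + 1) (Y γ) ((q : ℂ) ^ (-(N : ℤ) - 1)) ((q : ℂ) ^ (-(N : ℤ) - 1))
        γ (-1) q := by
  have h1 : 1 - γ * (q : ℂ) ≠ 0 := by
    rw [sub_ne_zero]
    simpa using (h 1 (by simp)).symm
  refine eq_of_eq_on_nonreal (z := γ)
    (f := fun w => Y w / (1 - w * q) *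
      qRacah n (Y w ^ 2 + 2 * w * q) ((q : ℂ) ^ (-2 * (N : ℤ) - 2)) q w w ((q : ℂ) ^ 2))
    (g := fun w => qRacah (2 * n + 1) (Y w) ((q : ℂ) ^ (-(N : ℤ) - 1))
      ((q : ℂ) ^ (-(N : ℤ) - 1)) w (-1) q) ?_ (continuousAt_qRacah_base h hY) hgen
  refine ContinuousAt.mul (hY.div (by fun_prop) h1) ?_
  exact continuousAt_qRacah_sq (i := 3) h (by omega) (by omega) (by omega) (by ring)
    (Y := fun w => Y w ^ 2 + 2 * w * q) (by fun_prop)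

theorem one_sub_ofReal_zpow_ne_zero (hq0 : 0 < q) (hq1 : q < 1) {z : ℤ} (hz : z ≠ 0) :
    1 - (q : ℂ) ^ z ≠ 0 := by
  rw [sub_ne_zero]
  intro h
  have h' : q ^ z = q ^ (0 : ℤ) := by rw [zpow_zero]; exact_mod_cast h.symm
  exact hz (zpow_right_injective₀ hq0 hq1.ne h')

theorem qPoch_zpow_sq_ne_zero (hq0 : 0 < q) (hq1 : q < 1) {z : ℤ} {k : ℕ}
    (hz : ∀ j < k, z + 2 * (j : ℤ) ≠ 0) : qPoch ((q : ℂ) ^ z) ((q : ℂ) ^ 2) k ≠ 0 := by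
  have hq : (q : ℂ) ≠ 0 := by exact_mod_cast hq0.ne'
  refine qPoch_ne_zero fun j hj => ?_
  rw [← pow_mul, ← zpow_natCast (q : ℂ) (2 * j), ← zpow_add₀ hq]
  refine one_sub_ofReal_zpow_ne_zero hq0 hq1 ?_
  have := hz j hj
  push_cast
  exact this

/-- The factors of `(q^{2r+1}; q²)_n` have odd exponents, so none is `1 - q^0`; those of `(q^{-2n};
q²)_n` and `(q^{-2N}; q²)_n` have negative exponents because `n ≤ N`. -/
theorem qRacahCoeff_sq_ne_zero {M i : ℕ} {β : ℂ} {r : ℤ} (hq0 : 0 < q) (hq1 : q < 1) (hnN : n ≤ N)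
    (h : ∀ j ∈ Finset.Icc 1 M, γ * (q : ℂ) ^ j ≠ 1) (hn : 2 * n ≤ M) (hi : 1 ≤ i)
    (hin : 2 * n + i ≤ M + 2) (hβ : β * (q : ℂ) ^ 2 = (q : ℂ) ^ i)
    (hr : (q : ℂ) ^ (-2 * (N : ℤ) - 2) * β * ((q : ℂ) ^ 2) ^ (n + 1) = (q : ℂ) ^ (2 * r + 1)) :
    qRacahCoeff n ((q : ℂ) ^ (-2 * (N : ℤ) - 2)) β γ γ ((q : ℂ) ^ 2) n ≠ 0 := by
  have hq : (q : ℂ) ≠ 0 := by exact_mod_cast hq0.ne'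
  rw [qRacahCoeff, latticeCoeff, hr, zpow_parameter_sq hq, zpow_terminating_sq,
    mul_right_comm β, hβ, mul_comm _ γ]
  have h1 : qPoch ((q : ℂ) ^ (-2 * (n : ℤ))) ((q : ℂ) ^ 2) n ≠ 0 :=
    qPoch_zpow_sq_ne_zero hq0 hq1 fun j hj => by omega
  have h2 : qPoch ((q : ℂ) ^ (2 * r + 1)) ((q : ℂ) ^ 2) n ≠ 0 :=
    qPoch_zpow_sq_ne_zero hq0 hq1 fun j hj => by omega
  have h3 : qPoch ((q : ℂ) ^ (-2 * (N : ℤ))) ((q : ℂ) ^ 2) n ≠ 0 :=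
    qPoch_zpow_sq_ne_zero hq0 hq1 fun j hj => by omega
  have h4 : qPoch (γ * (q : ℂ) ^ i) ((q : ℂ) ^ 2) n ≠ 0 :=
    qPoch_mul_pow_ne_zero h (by omega) (by omega)
  have h5 : qPoch (γ * (q : ℂ) ^ 2) ((q : ℂ) ^ 2) n ≠ 0 :=
    qPoch_mul_pow_ne_zero h (by omega) (by omega)
  have h6 : qPoch ((q : ℂ) ^ 2) ((q : ℂ) ^ 2) n ≠ 0 := by
    have := qPoch_zpow_sq_ne_zero hq0 hq1 (z := 2) (k := n) fun j hj => by omega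
    exact_mod_cast this
  positivity

open Polynomial in
theorem finite_setOf_qRacah_quadratic (hq0 : 0 < q) (hq1 : q < 1) (hnN : n ≤ N)
    (h : ∀ j ∈ Finset.Icc 1 (2 * n), γ * (q : ℂ) ^ j ≠ 1) {M : ℕ} (hM : M < 2 * n)
    (α β δ : ℂ) :
    {y : ℂ | qRacah n (y ^ 2 + 2 * γ * q) ((q : ℂ) ^ (-2 * (N : ℤ) - 2)) ((q : ℂ)⁻¹) γ γ
      ((q : ℂ) ^ 2) = qRacah M y α β γ δ q}.Finite := by
  have hq : (q : ℂ) ≠ 0 := by exact_mod_cast hq0.ne'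
  have hc := qRacahCoeff_sq_ne_zero (i := 1) (r := (n : ℤ) - N - 1) (β := (q : ℂ)⁻¹) hq0 hq1 hnN h
    le_rfl le_rfl (by omega) (by field_simp) (by
      rw [zpow_upper_sq_even hq]; congr 1; ring)
  have hd := natDegree_qRacahPoly n _ _ γ γ _ (pow_ne_zero 2 hq) hc
  have := finite_setOf_eval_eq
    (p := (qRacahPoly n ((q : ℂ) ^ (-2 * (N : ℤ) - 2)) ((q : ℂ)⁻¹) γ γ ((q : ℂ) ^ 2)).comp
      (X ^ 2 + C (2 * γ * q))) (r := qRacahPoly M α β γ δ q) (by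
      rw [natDegree_comp_quadratic, hd]
      have := natDegree_qRacahPoly_le M α β γ δ q hq
      omega)
  simpa only [eval_comp, eval_add, eval_pow, eval_X, eval_C, eval_qRacahPoly] using this

open Polynomial in
theorem finite_setOf_qRacah_quadratic_odd (hq0 : 0 < q) (hq1 : q < 1) (hnN : n ≤ N)
    (h : ∀ j ∈ Finset.Icc 1 (2 * n + 1), γ * (q : ℂ) ^ j ≠ 1) {M : ℕ} (hM : M < 2 * n + 1)
    (α β δ : ℂ) :
    {y : ℂ | y / (1 - γ * q) *
      qRacah n (y ^ 2 + 2 * γ * q) ((q : ℂ) ^ (-2 * (N : ℤ) - 2)) q γ γ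
      ((q : ℂ) ^ 2) = qRacah M y α β γ δ q}.Finite := by
  have hq : (q : ℂ) ≠ 0 := by exact_mod_cast hq0.ne'
  have h1 : 1 - γ * (q : ℂ) ≠ 0 := by
    rw [sub_ne_zero]
    simpa using (h 1 (by simp)).symm
  have hc := qRacahCoeff_sq_ne_zero (i := 3) (r := (n : ℤ) - N) (β := (q : ℂ)) hq0 hq1 hnN h
    (by omega) (by omega) (by omega) (by ring) (by
      rw [zpow_upper_sq_odd hq]; congr 1; ring)
  have hd := natDegree_qRacahPoly n _ _ γ γ _ (pow_ne_zero 2 hq) hc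
  set P := qRacahPoly n ((q : ℂ) ^ (-2 * (N : ℤ) - 2)) q γ γ ((q : ℂ) ^ 2) with hP
  -- Needed for the degree of `X` times the composite. If the composite were zero, its degree `2n`
  -- would be `0`, but for `n = 0` the polynomial is the constant `1`.
  have hcomp : (P.comp (X ^ 2 + C (2 * γ * q))) ≠ 0 := fun h0 => by
    have h2 := natDegree_comp_quadratic P (2 * γ * q)
    rw [h0, natDegree_zero, hd] at h2
    have hn0 : n = 0 := by omega
    subst hn0
    rw [eq_C_of_natDegree_eq_zero hd, C_comp, C_eq_zero] at h0
    have he := eval_qRacahPoly 0 ((q : ℂ) ^ (-2 * (N : ℤ) - 2)) q γ γ ((q : ℂ) ^ 2) 0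
    rw [← hP, eq_C_of_natDegree_eq_zero hd, h0] at he
    simp [qRacah, qPoch_zero] at he
  have := finite_setOf_eval_eq
    (p := C (1 - γ * q)⁻¹ * (X * P.comp (X ^ 2 + C (2 * γ * q))))
    (r := qRacahPoly M α β γ δ q) (by
      rw [natDegree_C_mul (inv_ne_zero h1), natDegree_X_mul hcomp, natDegree_comp_quadratic, hd]
      have := natDegree_qRacahPoly_le M α β γ δ q hq
      omega)
  simp only [eval_mul, eval_comp, eval_add, eval_pow, eval_X, eval_C, eval_qRacahPoly, hP] at this
  convert this using 4
  ring

end Transformations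

/-! ### Translation to `₄φ₃` series -/

section Series

variable {q : ℝ} (γ : ℂ) (N n : ℕ) (x : ℂ)

/-- Valid on the principal branch because `q` is positive, so `log q² = 2 log q`. -/
theorem sq_cpow (hq0 : 0 < q) (z : ℂ) : ((q : ℂ) ^ 2) ^ z = (q : ℂ) ^ (2 * z) := by
  have hq : (q : ℂ) ≠ 0 := by exact_mod_cast hq0.ne'
  have hq2 : ((q : ℂ) ^ 2) ≠ 0 := pow_ne_zero 2 hq
  have hlog : Complex.log ((q : ℂ) ^ 2) = 2 * Complex.log q := by
    rw [← Complex.ofReal_pow, ← Complex.ofReal_log (by positivity), Real.log_pow,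
      ← Complex.ofReal_log hq0.le]
    push_cast; ring
  rw [Complex.cpow_def_of_ne_zero hq2, Complex.cpow_def_of_ne_zero hq, hlog]
  congr 1
  ring

theorem lattice_sq (hq0 : 0 < q) :
    ((q : ℂ) ^ (-x) - γ * (q : ℂ) ^ (x + 1)) ^ 2 + 2 * γ * q =
      (q : ℂ) ^ (-2 * x) + γ ^ 2 * (q : ℂ) ^ (2 * x + 2) := by
  have hq : (q : ℂ) ≠ 0 := by exact_mod_cast hq0.ne'
  have h1 : (q : ℂ) ^ (-2 * x) = (q : ℂ) ^ (-x) * (q : ℂ) ^ (-x) := by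
    rw [← Complex.cpow_add _ _ hq]; congr 1; ring
  have h2 : (q : ℂ) ^ (2 * x + 2) = (q : ℂ) ^ (x + 1) * (q : ℂ) ^ (x + 1) := by
    rw [← Complex.cpow_add _ _ hq]; congr 1; ring
  have h3 : (q : ℂ) ^ (-x) * (q : ℂ) ^ (x + 1) = q := by
    rw [← Complex.cpow_add _ _ hq]; simp
  rw [h1, h2]
  linear_combination -2 * γ * h3

theorem lattice_natCast (hq0 : 0 < q) (m : ℕ) :
    (q : ℂ) ^ (-(m : ℂ)) - γ * (q : ℂ) ^ ((m : ℂ) + 1) =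
      ((q : ℂ) ^ m)⁻¹ - γ * q * (q : ℂ) ^ m := by
  have hq : (q : ℂ) ≠ 0 := by exact_mod_cast hq0.ne'
  rw [Complex.cpow_neg, Complex.cpow_add _ _ hq, Complex.cpow_natCast, Complex.cpow_one]
  ring

theorem qRacah_base_eq_qHyp43 (hq0 : 0 < q) (M : ℕ) :
    qRacah M ((q : ℂ) ^ (-x) - γ * (q : ℂ) ^ (x + 1)) ((q : ℂ) ^ (-(N : ℤ) - 1))
        ((q : ℂ) ^ (-(N : ℤ) - 1)) γ (-1) q =
      qHyp43 ((q : ℂ) ^ (-(M : ℤ))) ((q : ℂ) ^ ((M : ℤ) - 2 * N - 1)) ((q : ℂ) ^ (-x))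
        (-γ * (q : ℂ) ^ (x + 1)) ((q : ℂ) ^ (-(N : ℤ))) (-(q : ℂ) ^ (-(N : ℤ))) (γ * q) q q := by
  have hq : (q : ℂ) ≠ 0 := by exact_mod_cast hq0.ne'
  have h := qRacah_lattice M x ((q : ℂ) ^ (-(N : ℤ) - 1)) ((q : ℂ) ^ (-(N : ℤ) - 1)) γ (-1) q hq
  rw [zpow_upper_base hq, mul_neg_one, mul_neg_one, neg_mul _ (q : ℂ), zpow_parameter_base hq] at h
  rw [← h]
  congr 1
  ring

/-- The base `q` polynomials of degrees `M` and `2N + 1 - M` agree on the full lattice, where both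
are the same series with its first two upper parameters exchanged. -/
theorem qRacah_base_reflect (hq0 : 0 < q) {M M' : ℕ} (hM : M + M' = 2 * N + 1) :
    qRacah M ((q : ℂ) ^ (-x) - γ * (q : ℂ) ^ (x + 1)) ((q : ℂ) ^ (-(N : ℤ) - 1))
        ((q : ℂ) ^ (-(N : ℤ) - 1)) γ (-1) q =
      qRacah M' ((q : ℂ) ^ (-x) - γ * (q : ℂ) ^ (x + 1)) ((q : ℂ) ^ (-(N : ℤ) - 1))
        ((q : ℂ) ^ (-(N : ℤ) - 1)) γ (-1) q := by
  -- Here `M - 2N - 1 = -M'`. All numerators vanish beyond `min M M' ≤ N`, so the terms with `k >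
  -- N`, where `(q^{-N}; q)_k = 0`, are `0 / 0 = 0`.
  rw [qRacah_base_eq_qHyp43 _ _ _ hq0, qRacah_base_eq_qHyp43 _ _ _ hq0, qHyp43_swap_upper]
  congr 2 <;> omega

theorem qRacah_sq_eq_qHyp43 (hq0 : 0 < q) (β : ℂ) :
    qRacah n ((q : ℂ) ^ (-2 * x) + γ ^ 2 * (q : ℂ) ^ (2 * x + 2)) ((q : ℂ) ^ (-2 * (N : ℤ) - 2))
        β γ γ ((q : ℂ) ^ 2) =
      qHyp43 ((q : ℂ) ^ (-2 * (n : ℤ)))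
        ((q : ℂ) ^ (-2 * (N : ℤ) - 2) * β * ((q : ℂ) ^ 2) ^ (n + 1)) ((q : ℂ) ^ (-2 * x))
        (γ ^ 2 * (q : ℂ) ^ (2 * x + 2)) ((q : ℂ) ^ (-2 * (N : ℤ))) (β * γ * (q : ℂ) ^ 2)
        (γ * (q : ℂ) ^ 2) ((q : ℂ) ^ 2) ((q : ℂ) ^ 2) := by
  have hq : (q : ℂ) ≠ 0 := by exact_mod_cast hq0.ne'
  have h := qRacah_lattice n x ((q : ℂ) ^ (-2 * (N : ℤ) - 2)) β γ γ ((q : ℂ) ^ 2)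
    (pow_ne_zero 2 hq)
  rw [zpow_parameter_sq hq, zpow_terminating_sq, sq_cpow hq0, sq_cpow hq0, ← pow_two,
    mul_neg, ← neg_mul, mul_add, mul_one] at h
  exact h

end Series

end

/-! ### The quadratic transformations -/

theorem mainTheorem8 (q : ℝ) (hq0 : 0 < q) (hq1 : q < 1) (γ : ℂ) (N n : ℕ) (hN : 1 ≤ N)
    (hn : n ≤ N) :
    -- even transformation
    ((∀ j ∈ Finset.Icc 1 (2 * n), γ * (q : ℂ) ^ j ≠ 1) →
      (∀ x : ℂ, (2 * n ≤ N ∨ ∃ m : ℕ, m ≤ N ∧ x = m) →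
        qHyp43 ((q : ℂ) ^ (-2 * (n : ℤ))) ((q : ℂ) ^ (-2 * ((N : ℤ) - n) - 1)) ((q : ℂ) ^ (-x))
            (-γ * (q : ℂ) ^ (x + 1)) ((q : ℂ) ^ (-(N : ℤ))) (-(q : ℂ) ^ (-(N : ℤ))) (γ * q) q q =
          qHyp43 ((q : ℂ) ^ (-2 * (n : ℤ))) ((q : ℂ) ^ (2 * (n : ℤ) - 2 * N - 1))
            ((q : ℂ) ^ (-2 * x)) (γ ^ 2 * (q : ℂ) ^ (2 * x + 2)) ((q : ℂ) ^ (-2 * (N : ℤ)))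
            (γ * q) (γ * (q : ℂ) ^ 2) ((q : ℂ) ^ 2) ((q : ℂ) ^ 2)) ∧
      (2 * n ≤ N →
        (∀ y : ℂ,
          qRacah n (y ^ 2 + 2 * γ * q) ((q : ℂ) ^ (-2 * (N : ℤ) - 2)) ((q : ℂ)⁻¹) γ γ
              ((q : ℂ) ^ 2) =
            qRacah (2 * n) y ((q : ℂ) ^ (-(N : ℤ) - 1)) ((q : ℂ) ^ (-(N : ℤ) - 1)) γ (-1) q) ∧
        (∀ x : ℂ,
          qRacah n ((q : ℂ) ^ (-2 * x) + γ ^ 2 * (q : ℂ) ^ (2 * x + 2))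
              ((q : ℂ) ^ (-2 * (N : ℤ) - 2)) ((q : ℂ)⁻¹) γ γ ((q : ℂ) ^ 2) =
            qRacah (2 * n) ((q : ℂ) ^ (-x) - γ * (q : ℂ) ^ (x + 1))
              ((q : ℂ) ^ (-(N : ℤ) - 1)) ((q : ℂ) ^ (-(N : ℤ) - 1)) γ (-1) q)) ∧
      (N < 2 * n →
        (∀ x : ℕ, x ≤ N →
          qRacah n ((q : ℂ) ^ (-2 * (x : ℂ)) + γ ^ 2 * (q : ℂ) ^ (2 * (x : ℂ) + 2))
              ((q : ℂ) ^ (-2 * (N : ℤ) - 2)) ((q : ℂ)⁻¹) γ γ ((q : ℂ) ^ 2) =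
            qRacah (2 * N + 1 - 2 * n) ((q : ℂ) ^ (-(x : ℂ)) - γ * (q : ℂ) ^ ((x : ℂ) + 1))
              ((q : ℂ) ^ (-(N : ℤ) - 1)) ((q : ℂ) ^ (-(N : ℤ) - 1)) γ (-1) q) ∧
        {y : ℂ |
          qRacah n (y ^ 2 + 2 * γ * q) ((q : ℂ) ^ (-2 * (N : ℤ) - 2)) ((q : ℂ)⁻¹) γ γ
              ((q : ℂ) ^ 2) =
            qRacah (2 * N + 1 - 2 * n) y ((q : ℂ) ^ (-(N : ℤ) - 1)) ((q : ℂ) ^ (-(N : ℤ) - 1))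
              γ (-1) q}.Finite)) ∧
    -- odd transformation
    ((∀ j ∈ Finset.Icc 1 (2 * n + 1), γ * (q : ℂ) ^ j ≠ 1) →
      (∀ x : ℂ, (2 * n + 1 ≤ N ∨ ∃ m : ℕ, m ≤ N ∧ x = m) →
        qHyp43 ((q : ℂ) ^ (-2 * (n : ℤ) - 1)) ((q : ℂ) ^ (-2 * ((N : ℤ) - n))) ((q : ℂ) ^ (-x))
            (-γ * (q : ℂ) ^ (x + 1)) ((q : ℂ) ^ (-(N : ℤ))) (-(q : ℂ) ^ (-(N : ℤ))) (γ * q) q q =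
          ((q : ℂ) ^ (-x) - γ * (q : ℂ) ^ (x + 1)) / (1 - γ * q) *
            qHyp43 ((q : ℂ) ^ (-2 * (n : ℤ))) ((q : ℂ) ^ (2 * (n : ℤ) - 2 * N + 1))
              ((q : ℂ) ^ (-2 * x)) (γ ^ 2 * (q : ℂ) ^ (2 * x + 2)) ((q : ℂ) ^ (-2 * (N : ℤ)))
              (γ * (q : ℂ) ^ 2) (γ * (q : ℂ) ^ 3) ((q : ℂ) ^ 2) ((q : ℂ) ^ 2)) ∧
      (2 * n + 1 ≤ N →
        (∀ y : ℂ,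
          y / (1 - γ * q) *
              qRacah n (y ^ 2 + 2 * γ * q) ((q : ℂ) ^ (-2 * (N : ℤ) - 2)) q γ γ ((q : ℂ) ^ 2) =
            qRacah (2 * n + 1) y ((q : ℂ) ^ (-(N : ℤ) - 1)) ((q : ℂ) ^ (-(N : ℤ) - 1))
              γ (-1) q) ∧
        (∀ x : ℂ,
          ((q : ℂ) ^ (-x) - γ * (q : ℂ) ^ (x + 1)) / (1 - γ * q) *
              qRacah n ((q : ℂ) ^ (-2 * x) + γ ^ 2 * (q : ℂ) ^ (2 * x + 2))
                ((q : ℂ) ^ (-2 * (N : ℤ) - 2)) q γ γ ((q : ℂ) ^ 2) =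
            qRacah (2 * n + 1) ((q : ℂ) ^ (-x) - γ * (q : ℂ) ^ (x + 1))
              ((q : ℂ) ^ (-(N : ℤ) - 1)) ((q : ℂ) ^ (-(N : ℤ) - 1)) γ (-1) q)) ∧
      (N < 2 * n + 1 →
        (∀ x : ℕ, x ≤ N →
          ((q : ℂ) ^ (-(x : ℂ)) - γ * (q : ℂ) ^ ((x : ℂ) + 1)) / (1 - γ * q) *
              qRacah n ((q : ℂ) ^ (-2 * (x : ℂ)) + γ ^ 2 * (q : ℂ) ^ (2 * (x : ℂ) + 2))
                ((q : ℂ) ^ (-2 * (N : ℤ) - 2)) q γ γ ((q : ℂ) ^ 2) =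
            qRacah (2 * N - 2 * n) ((q : ℂ) ^ (-(x : ℂ)) - γ * (q : ℂ) ^ ((x : ℂ) + 1))
              ((q : ℂ) ^ (-(N : ℤ) - 1)) ((q : ℂ) ^ (-(N : ℤ) - 1)) γ (-1) q) ∧
        {y : ℂ |
          y / (1 - γ * q) *
              qRacah n (y ^ 2 + 2 * γ * q) ((q : ℂ) ^ (-2 * (N : ℤ) - 2)) q γ γ ((q : ℂ) ^ 2) =
            qRacah (2 * N - 2 * n) y ((q : ℂ) ^ (-(N : ℤ) - 1)) ((q : ℂ) ^ (-(N : ℤ) - 1))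
              γ (-1) q}.Finite)) := by
  have hq : (q : ℂ) ≠ 0 := by exact_mod_cast hq0.ne'
  have hcont : ∀ m : ℕ, Continuous fun w : ℂ => ((q : ℂ) ^ m)⁻¹ - w * q * (q : ℂ) ^ m :=
    fun m => by fun_prop
  refine ⟨fun h => ?_, fun h => ?_⟩
  · have hpoly : 2 * n ≤ N → ∀ y : ℂ, _ := fun hnN y =>
      qRacah_quadratic_of_generic (N := N) hq0 h (Y := fun _ => y) continuousAt_const
        fun w hw => qRacah_quadratic_generic hq0 hq1 hw hnN y
    have hlat : ∀ m ≤ N, _ := fun m (hm : m ≤ N) =>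
      qRacah_quadratic_of_generic (N := N) hq0 h (hcont m).continuousAt
        fun w hw => qRacah_quadratic_lattice_generic hq0 hq1 hw n hm
    have hmain : ∀ x : ℂ, (2 * n ≤ N ∨ ∃ m : ℕ, m ≤ N ∧ x = m) →
        qRacah n ((q : ℂ) ^ (-2 * x) + γ ^ 2 * (q : ℂ) ^ (2 * x + 2))
            ((q : ℂ) ^ (-2 * (N : ℤ) - 2)) ((q : ℂ)⁻¹) γ γ ((q : ℂ) ^ 2) =
          qRacah (2 * n) ((q : ℂ) ^ (-x) - γ * (q : ℂ) ^ (x + 1))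
            ((q : ℂ) ^ (-(N : ℤ) - 1)) ((q : ℂ) ^ (-(N : ℤ) - 1)) γ (-1) q := by
      rintro x (hnN | ⟨m, hm, rfl⟩)
      · rw [← lattice_sq γ x hq0]
        exact hpoly hnN _
      · rw [← lattice_sq γ m hq0, lattice_natCast γ hq0]
        exact hlat m hm
    refine ⟨fun x hx => ?_, fun hnN => ⟨hpoly hnN, fun x => hmain x (Or.inl hnN)⟩,
      fun hnN => ⟨fun x hx => ?_, ?_⟩⟩
    · have := hmain x hx
      rw [qRacah_sq_eq_qHyp43 _ _ _ _ hq0, qRacah_base_eq_qHyp43 _ _ _ hq0,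
        zpow_upper_sq_even hq, show (q : ℂ)⁻¹ * γ * q ^ 2 = γ * q by field_simp] at this
      rw [this]
      congr 2
      · push_cast; ring
    · rw [hmain x (Or.inr ⟨x, hx, rfl⟩)]
      exact qRacah_base_reflect γ N x hq0 (by omega)
    · exact finite_setOf_qRacah_quadratic hq0 hq1 hn h (by omega) _ _ _
  · have hpoly : 2 * n + 1 ≤ N → ∀ y : ℂ, _ := fun hnN y =>
      qRacah_quadratic_odd_of_generic (N := N) h (Y := fun _ => y) continuousAt_const
        fun w hw => qRacah_quadratic_odd_generic hq0 hq1 hw hnN y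
    have hlat : ∀ m ≤ N, _ := fun m (hm : m ≤ N) =>
      qRacah_quadratic_odd_of_generic (N := N) h (hcont m).continuousAt
        fun w hw => qRacah_quadratic_odd_lattice_generic hq0 hq1 hw n hm
    have hmain : ∀ x : ℂ, (2 * n + 1 ≤ N ∨ ∃ m : ℕ, m ≤ N ∧ x = m) →
        ((q : ℂ) ^ (-x) - γ * (q : ℂ) ^ (x + 1)) / (1 - γ * q) *
          qRacah n ((q : ℂ) ^ (-2 * x) + γ ^ 2 * (q : ℂ) ^ (2 * x + 2))
            ((q : ℂ) ^ (-2 * (N : ℤ) - 2)) q γ γ ((q : ℂ) ^ 2) =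
          qRacah (2 * n + 1) ((q : ℂ) ^ (-x) - γ * (q : ℂ) ^ (x + 1))
            ((q : ℂ) ^ (-(N : ℤ) - 1)) ((q : ℂ) ^ (-(N : ℤ) - 1)) γ (-1) q := by
      rintro x (hnN | ⟨m, hm, rfl⟩)
      · rw [← lattice_sq γ x hq0]
        exact hpoly hnN _
      · rw [← lattice_sq γ m hq0, lattice_natCast γ hq0]
        exact hlat m hm
    refine ⟨fun x hx => ?_, fun hnN => ⟨hpoly hnN, fun x => hmain x (Or.inl hnN)⟩,
      fun hnN => ⟨fun x hx => ?_, ?_⟩⟩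
    · have := hmain x hx
      rw [qRacah_sq_eq_qHyp43 _ _ _ _ hq0, qRacah_base_eq_qHyp43 _ _ _ hq0, qHyp43_swap_lower,
        zpow_upper_sq_odd hq, show (q : ℂ) * γ * q ^ 2 = γ * q ^ 3 by ring] at this
      rw [this]
      congr 2
      · push_cast; ring
      · push_cast; ring
    · rw [hmain x (Or.inr ⟨x, hx, rfl⟩)]
      exact qRacah_base_reflect γ N x hq0 (by omega)
    · exact finite_setOf_qRacah_quadratic_odd hq0 hq1 hn h (by omega) _ _ _
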